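/- Theorem 3.1. Let $\mathtt{two\_optima}$ be the abstract simplicial complex on the vertex set $\{1,\dots,106\}$ whose facets are the following $12$ triangles and $573$ tetrahedra (a string of vertices denotes the set of these vertices): (a) the 12 triangles $1\,3\,23$, $1\,22\,23$, $1\,22\,24$, $1\,22\,25$, $1\,24\,25$, $2\,3\,25$, $2\,22\,23$, $2\,22\,24$, $2\,22\,25$, $2\,23\,24$, $3\,23\,25$, $23\,24\,25$; (b) for each $x=7,\dots,13$, with $y=x+7$, the 12 tetrahedra $1\,2\,5\,x$, $1\,2\,6\,x$, $1\,3\,5\,x$, $1\,4\,6\,x$, $2\,5\,6\,x$, $3\,4\,6\,x$, $3\,5\,6\,x$, $1\,3\,x\,y$, $1\,4\,x\,y$, $3\,4\,x\,y$, $1\,2\,4\,y$, $2\,3\,4\,y$; (c) the 30 tetrahedra $2\,3\,14\,15$, $1\,2\,15\,16$, $1\,3\,16\,17$, $2\,3\,17\,18$, $1\,2\,18\,19$, $1\,3\,14\,19$, $1\,3\,15\,20$, $1\,2\,17\,20$, $2\,3\,19\,20$, $1\,15\,16\,17$, $1\,15\,17\,20$, $2\,17\,18\,19$, $2\,17\,19\,20$,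 $3\,14\,15\,19$, $3\,15\,19\,20$, $15\,17\,19\,20$, $1\,2\,14\,21$, $1\,3\,18\,21$, $1\,14\,19\,21$, $1\,18\,19\,21$, $2\,3\,16\,21$, $2\,14\,15\,21$, $2\,15\,16\,21$, $3\,16\,17\,21$, $3\,17\,18\,21$, $14\,15\,19\,21$, $15\,16\,17\,21$, $15\,17\,19\,21$, $17\,18\,19\,21$, $1\,2\,3\,21$; (d) for $j=0,\dots,8$, with $a=26+9j$, $a_k=a+k$, and $t_1\,t_2\,t_3$ the $(j+1)$-st of the triangles $1\,2\,5$, $1\,2\,6$, $1\,2\,4$, $1\,3\,5$, $1\,4\,6$, $2\,3\,4$, $2\,5\,6$, $3\,4\,6$, $3\,5\,6$, the 51 tetrahedra $t_1\,t_2\,a\,a_k$, $t_1\,t_3\,a\,a_k$, $t_2\,t_3\,a\,a_k$ ($k=1,\dots,7$), $t_2\,t_3\,a_1\,a_2$, $t_1\,t_2\,a_2\,a_3$, $t_1\,t_3\,a_3\,a_4$, $t_2\,t_3\,a_4\,a_5$, $t_1\,t_2\,a_5\,a_6$, $t_1\,t_3\,a_6\,a_1$, $t_1\,t_3\,a_2\,a_7$,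 $t_1\,t_2\,a_4\,a_7$, $t_2\,t_3\,a_6\,a_7$, $t_1\,a_2\,a_3\,a_4$, $t_1\,a_2\,a_4\,a_7$, $t_2\,a_4\,a_5\,a_6$, $t_2\,a_4\,a_6\,a_7$, $t_3\,a_1\,a_2\,a_6$, $t_3\,a_2\,a_6\,a_7$, $a_2\,a_4\,a_6\,a_7$, $t_1\,t_2\,t_3\,a_8$, $t_1\,t_2\,a_1\,a_8$, $t_1\,t_3\,a_5\,a_8$, $t_2\,t_3\,a_3\,a_8$, $t_1\,a_1\,a_6\,a_8$, $t_1\,a_5\,a_6\,a_8$, $t_2\,a_1\,a_2\,a_8$, $t_2\,a_2\,a_3\,a_8$, $t_3\,a_3\,a_4\,a_8$, $t_3\,a_4\,a_5\,a_8$, $a_1\,a_2\,a_6\,a_8$, $a_2\,a_3\,a_4\,a_8$, $a_4\,a_5\,a_6\,a_8$, $a_2\,a_4\,a_6\,a_8$. A face of a finite simplicial complex is free if exactly one face properly contains it; an elementary collapse deletes a free face together with the face properly containing it; a complex is collapsible if it can be reduced to a single vertex by elementary collapses. A vector $(c_0,\dots,c_d)$ is a discrete Morse vector of a $d$-dimensional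 complex if the complex can be reduced to the empty complex by a sequence of steps, each an elementary collapse or the deletion of a single inclusion-maximal face (a critical face), in which exactly $c_i$ critical faces of dimension $i$ are deleted, for each $i$. It is optimal if no discrete Morse vector of the complex has a smaller sum $c_0+\dots+c_d$. Then $\mathtt{two\_optima}$ is a $3$-dimensional simplicial complex with face vector $f=(106,596,1064,573)$ ($f_i$ being the number of $i$-dimensional faces), its geometric realization is contractible, it is not collapsible, and it has exactly two optimal discrete Morse vectors, $(1,1,1,0)$ and $(1,0,1,1)$. -/

import Mathlib

namespace PreAbstractSimplicialComplex

/-- `K` has dimension `d`: a face with `k + 1` vertices is a `k`-face. -/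
def HasDim {V : Type*} (K : PreAbstractSimplicialComplex V) (d : ℕ) : Prop :=
  (∀ σ ∈ K.faces, σ.card ≤ d + 1) ∧ ∃ σ ∈ K.faces, σ.card = d + 1

/-- The face vector `(f₀, …, f_d)`, where `f_i` is the number of `i`-faces. -/
noncomputable def fVector {V : Type*} (K : PreAbstractSimplicialComplex V) (d : ℕ) :
    Fin (d + 1) → ℕ :=
  fun i => Set.ncard {σ : Finset V | σ ∈ K.faces ∧ σ.card = (i : ℕ) + 1}

/-- The geometric realization of a finite complex in barycentric coordinates: nonnegative
functions of total mass one that are supported on a face, with the topology of pointwise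
convergence. -/
def realization {V : Type*} (K : PreAbstractSimplicialComplex V) : Set (V → ℝ) :=
  {x | (∀ v, 0 ≤ x v) ∧ ∃ σ ∈ K.faces, (∀ v, v ∉ σ → x v = 0) ∧ ∑ v ∈ σ, x v = 1}

/-- `σ` is a free face of `K` and `τ` is the unique face of `K` that properly contains it.
(Then `τ` has exactly one vertex more than `σ`, since `K` is closed under passing to faces.) -/
def IsFreePair {V : Type*} (K : PreAbstractSimplicialComplex V) (σ τ : Finset V) : Prop :=
  σ ∈ K.faces ∧ τ ∈ K.faces ∧ σ ⊂ τ ∧ ∀ ρ ∈ K.faces, σ ⊂ ρ → ρ = τ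

/-- `L` arises from `K` by an elementary collapse: a free face is deleted together with the
unique face properly containing it. -/
def ElementaryCollapse {V : Type*} (K L : PreAbstractSimplicialComplex V) : Prop :=
  ∃ σ τ : Finset V, K.IsFreePair σ τ ∧ L.faces = K.faces \ {σ, τ}

/-- `K` can be reduced to a single vertex by a finite sequence of elementary collapses. -/
def Collapsible {V : Type*} (K : PreAbstractSimplicialComplex V) : Prop :=
  ∃ (L : PreAbstractSimplicialComplex V) (v : V),
    Relation.ReflTransGen ElementaryCollapse K L ∧ L.faces = {{v}}

/-- `K.Deconstructs c`: `K` can be reduced to the empty complex by a finite sequence of steps,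
each an elementary collapse or the deletion of a single inclusion-maximal face, called a
critical face, such that `c i` is the number of critical faces of dimension `i`.
In particular the last vertex to be deleted is critical. -/
inductive Deconstructs {V : Type*} {d : ℕ} :
    PreAbstractSimplicialComplex V → (Fin (d + 1) → ℕ) → Prop
  | empty (K : PreAbstractSimplicialComplex V) (hK : K.faces = ∅) : Deconstructs K 0
  | collapse (K L : PreAbstractSimplicialComplex V) (c : Fin (d + 1) → ℕ)
      (hKL : ElementaryCollapse K L) (hL : Deconstructs L c) : Deconstructs K c
  | critical (K L : PreAbstractSimplicialComplex V) (c : Fin (d + 1) → ℕ)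
      (σ : Finset V) (i : Fin (d + 1)) (hσ : Maximal (fun ρ => ρ ∈ K.faces) σ)
      (hi : σ.card = (i : ℕ) + 1) (hKL : L.faces = K.faces \ {σ}) (hL : Deconstructs L c) :
      Deconstructs K (c + Pi.single i 1)

/-- `c = (c₀, …, c_d)` is a discrete Morse vector of the `d`-dimensional complex `K`. -/
def IsDiscreteMorseVector {V : Type*} {d : ℕ} (K : PreAbstractSimplicialComplex V)
    (c : Fin (d + 1) → ℕ) : Prop :=
  K.HasDim d ∧ K.Deconstructs c

/-- A discrete Morse vector is optimal if it minimizes the total number of critical faces. -/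
def IsOptimalDiscreteMorseVector {V : Type*} {d : ℕ} (K : PreAbstractSimplicialComplex V)
    (c : Fin (d + 1) → ℕ) : Prop :=
  K.IsDiscreteMorseVector c ∧
    ∀ c' : Fin (d + 1) → ℕ, K.IsDiscreteMorseVector c' → ∑ i, c i ≤ ∑ i, c' i

/-- The complex generated by a list of finite sets: all their nonempty subsets. -/
def generatedBy {V : Type*} (F : List (Finset V)) : PreAbstractSimplicialComplex V where
  faces := {σ | σ.Nonempty ∧ ∃ τ ∈ F, σ ⊆ τ}
  isRelLowerSet_faces := by
    rintro σ ⟨hσ, τ, hτ, hστ⟩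
    exact ⟨hσ, fun ρ hρσ hρ => ⟨hρ, τ, hτ, hρσ.trans hστ⟩⟩

end PreAbstractSimplicialComplex

namespace TwoOptima

/-- The 12 triangles of `Σ₂` other than its triangle `1 2 3`, which lies in a tetrahedron of
the next list. -/
def sigma2 : List (Finset ℕ) :=
  [{1, 3, 23}, {1, 22, 23}, {1, 22, 24}, {1, 22, 25}, {1, 24, 25}, {2, 3, 25},
   {2, 22, 23}, {2, 22, 24}, {2, 22, 25}, {2, 23, 24}, {3, 23, 25}, {23, 24, 25}]

/-- The two-fold cone over the subdivided triangle, with apices `x` and `y`. -/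
def doubleCone (x y : ℕ) : List (Finset ℕ) :=
  [{1, 2, 5, x}, {1, 2, 6, x}, {1, 3, 5, x}, {1, 4, 6, x}, {2, 5, 6, x}, {3, 4, 6, x},
   {3, 5, 6, x},
   {1, 3, x, y}, {1, 4, x, y}, {3, 4, x, y}, {1, 2, 4, y}, {2, 3, 4, y}]

/-- The 114 tetrahedra of the modified copy `Σ₃'` of `Σ₃`. -/
def sigma3Modified : List (Finset ℕ) :=
  [7, 8, 9, 10, 11, 12, 13].flatMap (fun x => doubleCone x (x + 7)) ++
  [{2, 3, 14, 15}, {1, 2, 15, 16}, {1, 3, 16, 17}, {2, 3, 17, 18}, {1, 2, 18, 19},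
   {1, 3, 14, 19},
   {1, 3, 15, 20}, {1, 2, 17, 20}, {2, 3, 19, 20},
   {1, 15, 16, 17}, {1, 15, 17, 20}, {2, 17, 18, 19}, {2, 17, 19, 20}, {3, 14, 15, 19},
   {3, 15, 19, 20}, {15, 17, 19, 20},
   {1, 2, 14, 21}, {1, 3, 18, 21}, {1, 14, 19, 21}, {1, 18, 19, 21}, {2, 3, 16, 21},
   {2, 14, 15, 21}, {2, 15, 16, 21}, {3, 16, 17, 21}, {3, 17, 18, 21}, {14, 15, 19, 21},
   {15, 16, 17, 21}, {15, 17, 19, 21}, {17, 18, 19, 21}, {1, 2, 3, 21}]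

/-- The 51 tetrahedra of a copy of `Σ₃` whose free triangle is `t₁ t₂ t₃` and whose nine further
vertices are `a, a + 1, …, a + 8`. -/
def sigma3Copy (t₁ t₂ t₃ a : ℕ) : List (Finset ℕ) :=
  [1, 2, 3, 4, 5, 6, 7].flatMap
    (fun k => [{t₁, t₂, a, a + k}, {t₁, t₃, a, a + k}, {t₂, t₃, a, a + k}]) ++
  [{t₂, t₃, a + 1, a + 2}, {t₁, t₂, a + 2, a + 3}, {t₁, t₃, a + 3, a + 4},
   {t₂, t₃, a + 4, a + 5}, {t₁, t₂, a + 5, a + 6}, {t₁, t₃, a + 6, a + 1},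
   {t₁, t₃, a + 2, a + 7}, {t₁, t₂, a + 4, a + 7}, {t₂, t₃, a + 6, a + 7},
   {t₁, a + 2, a + 3, a + 4}, {t₁, a + 2, a + 4, a + 7},
   {t₂, a + 4, a + 5, a + 6}, {t₂, a + 4, a + 6, a + 7},
   {t₃, a + 1, a + 2, a + 6}, {t₃, a + 2, a + 6, a + 7},
   {a + 2, a + 4, a + 6, a + 7},
   {t₁, t₂, t₃, a + 8},
   {t₁, t₂, a + 1, a + 8}, {t₁, t₃, a + 5, a + 8}, {t₂, t₃, a + 3, a + 8},
   {t₁, a + 1, a + 6, a + 8}, {t₁, a + 5, a + 6, a + 8},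
   {t₂, a + 1, a + 2, a + 8}, {t₂, a + 2, a + 3, a + 8},
   {t₃, a + 3, a + 4, a + 8}, {t₃, a + 4, a + 5, a + 8},
   {a + 1, a + 2, a + 6, a + 8}, {a + 2, a + 3, a + 4, a + 8}, {a + 4, a + 5, a + 6, a + 8},
   {a + 2, a + 4, a + 6, a + 8}]

/-- The facets of the complex, on the vertex set `{1, …, 106}`: the nine copies of `Σ₃` are
glued along the nine triangles that subdivide the triangle `1 2 3`. -/
def facets : List (Finset ℕ) :=
  sigma2 ++ sigma3Modified ++
  sigma3Copy 1 2 5 26 ++ sigma3Copy 1 2 6 35 ++ sigma3Copy 1 2 4 44 ++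
  sigma3Copy 1 3 5 53 ++ sigma3Copy 1 4 6 62 ++ sigma3Copy 2 3 4 71 ++
  sigma3Copy 2 5 6 80 ++ sigma3Copy 3 4 6 89 ++ sigma3Copy 3 5 6 98

end TwoOptima

/-- The complex `two_optima`. -/
def twoOptima : PreAbstractSimplicialComplex ℕ :=
  PreAbstractSimplicialComplex.generatedBy TwoOptima.facets

/-! The complex is the union of a two-dimensional part `Σ₂` and a three-dimensional part `B` (`Σ₃'`
with the nine copies of `Σ₃`), meeting in the triangle `1 2 3`. `Σ₂` collapses to a vertex, but its
only free edge is `1 2`, which lies in no triangle of `Σ₂` but `1 2 3`. In `B` that triangle is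
free, being contained in `21 1 2 3` alone, and `B` collapses to a vertex once it is entered there.
So a choice arises: collapsing through `1 2 3` opens `Σ₂` and costs a critical edge; keeping it
costs the critical tetrahedron `21 1 2 3`. Either way the edge `2 3` is needed twice, which costs
one critical triangle.

For contractibility, the cone over `B` is attached. Because `B` collapses to a vertex, the enlarged
complex collapses back to the original one; pairing each face of `B` outside `1 2 3` with its cone,
it also collapses to `Σ₂` with a cone over `1 2 3`, hence to a vertex.

The essential bound is that a critical triangle is unavoidable (`IsBlockFamily.one_le_two`). The
nine free triangles of the copies and the twelve triangles of `Σ₂` form a 2-complex without free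
edges. Suppose that no critical triangle occurs. Since there are no 3-cycles modulo two, no critical
tetrahedron occurs either (`Deconstructs.three_eq_zero`): its boundary would be filled in the rest.
In a deconstruction with critical vertices and edges only, each base triangle can be replaced by a
mod-two chain of its block with the same boundary, and these chains survive every step
(`IsBlockFamily.exists_chain_of_collapse`), so the empty complex is never reached.

With `c 0 ≥ 1`, `c 2 ≥ 1` and the Euler relation `c 0 - c 1 + c 2 - c 3 = 1`, the sum is at least 3,
with equality only for the two vectors claimed. Explicit sequences, verified by kernel evaluation,
realize both. -/

namespace PreAbstractSimplicialComplex

/-! ### Elementary collapses as deformation retractions of the realization -/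

section Realization

variable {V : Type*}

open Classical in
/-- The straight-line push away from the barycentre of `σ` towards the vertex `v`. -/
noncomputable def push (σ : Finset V) (hσ : σ.Nonempty) (v : V) (s : ℝ) (x : V → ℝ) : V → ℝ :=
  fun w => x w + s * σ.inf' hσ x *
    ((if w = v then (σ.card : ℝ) else 0) - if w ∈ σ then 1 else 0)

theorem continuous_push (σ : Finset V) (hσ : σ.Nonempty) (v : V) :
    Continuous fun p : ℝ × (V → ℝ) => push σ hσ v p.1 p.2 := by
  unfold push
  refine continuous_pi fun w => ?_
  have h : Continuous fun p : ℝ × (V → ℝ) => σ.inf' hσ p.2 := by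
    have := Continuous.finset_inf'_apply (X := ℝ × (V → ℝ)) (L := ℝ)
      (s := σ) (f := fun w p => p.2 w) hσ
      (fun w _ => by fun_prop)
    exact this
  fun_prop

theorem push_zero (σ : Finset V) (hσ : σ.Nonempty) (v : V) (x : V → ℝ) :
    push σ hσ v 0 x = x := by
  ext w; simp [push]

theorem inf'_eq_zero {σ ρ : Finset V} (hσ : σ.Nonempty) {x : V → ℝ} (hx : ∀ v, 0 ≤ x v)
    (hρ : ∀ v, v ∉ ρ → x v = 0) (h : ¬ σ ⊆ ρ) : σ.inf' hσ x = 0 := by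
  obtain ⟨w, hw, hwρ⟩ := Finset.not_subset.1 h
  apply le_antisymm
  · exact (Finset.inf'_le x hw).trans (hρ w hwρ).le
  · exact Finset.le_inf' hσ _ fun b _ => hx b

theorem push_of_inf'_eq_zero {σ : Finset V} (hσ : σ.Nonempty) {x : V → ℝ}
    (h : σ.inf' hσ x = 0) (v : V) (s : ℝ) : push σ hσ v s x = x := by
  ext w; simp [push, h]

theorem push_nonneg {σ : Finset V} (hσ : σ.Nonempty) {x : V → ℝ} (hx : ∀ v, 0 ≤ x v)
    {v : V} {s : ℝ} (h0 : 0 ≤ s) (h1 : s ≤ 1) (w : V) : 0 ≤ push σ hσ v s x w := by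
  have hm : 0 ≤ σ.inf' hσ x := Finset.le_inf' hσ _ fun b _ => hx b
  have hsm : s * σ.inf' hσ x ≤ σ.inf' hσ x := mul_le_of_le_one_left hm h1
  have hsm0 := mul_nonneg h0 hm
  have hxw := hx w
  unfold push
  have hcard : (0 : ℝ) ≤ σ.card := by positivity
  have hp := mul_nonneg hsm0 hcard
  split_ifs with hwv hw hw
  · have := Finset.inf'_le x hw
    nlinarith
  · nlinarith
  · have := Finset.inf'_le x hw
    nlinarith
  · nlinarith

open Classical in
theorem sum_push {σ : Finset V} (hσ : σ.Nonempty) (v : V) (s : ℝ) (x : V → ℝ) :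
    ∑ w ∈ insert v σ, push σ hσ v s x w = ∑ w ∈ insert v σ, x w := by
  simp only [push, Finset.sum_add_distrib, ← Finset.mul_sum, Finset.sum_sub_distrib]
  rw [Finset.sum_ite_eq' (insert v σ) v, Finset.sum_ite_mem, Finset.inter_eq_right.2 (by simp)]
  simp

/-- A face properly containing another one uniquely has just one vertex more. -/
theorem IsFreePair.exists_eq_insert [DecidableEq V] {K : PreAbstractSimplicialComplex V}
    {σ τ : Finset V} (h : K.IsFreePair σ τ) : ∃ v ∉ σ, τ = insert v σ := by
  obtain ⟨-, hτ, hst, huniq⟩ := h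
  obtain ⟨v, hv, hvσ⟩ := Finset.exists_of_ssubset hst
  refine ⟨v, hvσ, (huniq _ ?_ (Finset.ssubset_insert hvσ)).symm⟩
  exact (K.isRelLowerSet_faces hτ).2 (Finset.insert_subset hv hst.1) (Finset.insert_nonempty _ _)

theorem IsFreePair.subset_iff {K : PreAbstractSimplicialComplex V}
    {σ τ : Finset V} (h : K.IsFreePair σ τ) {ρ : Finset V} (hρ : ρ ∈ K.faces) :
    σ ⊆ ρ ↔ ρ = σ ∨ ρ = τ := by
  constructor
  · intro hs
    rcases hs.eq_or_ssubset with e | e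
    · exact Or.inl e.symm
    · exact Or.inr (h.2.2.2 ρ hρ e)
  · rintro (rfl | rfl)
    · exact subset_rfl
    · exact h.2.2.1.1

open Classical in
theorem push_mem_realization {K : PreAbstractSimplicialComplex V} {σ : Finset V} {v : V}
    (hσ : σ.Nonempty) (hv : v ∉ σ) (h : K.IsFreePair σ (insert v σ)) {s : ℝ} (h0 : 0 ≤ s)
    (h1 : s ≤ 1) {x : V → ℝ} (hx : x ∈ K.realization) :
    push σ hσ v s x ∈ K.realization := by
  obtain ⟨hx0, ρ, hρ, hsupp, hsum⟩ := hx
  by_cases hsub : σ ⊆ ρ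
  · have hρτ : ρ ⊆ insert v σ := by
      rcases (h.subset_iff hρ).1 hsub with rfl | rfl
      · exact Finset.subset_insert _ _
      · exact subset_rfl
    refine ⟨push_nonneg hσ hx0 h0 h1, insert v σ, h.2.1, fun w hw => ?_, ?_⟩
    · have hwv : w ≠ v := fun e => hw (by simp [e])
      have hwσ : w ∉ σ := fun e => hw (by simp [e])
      simp [push, hwv, hwσ, hsupp w fun e => hw (hρτ e)]
    · rw [sum_push hσ v, ← hsum]
      exact (Finset.sum_subset hρτ fun w _ hw => hsupp w hw).symm
  · rw [push_of_inf'_eq_zero hσ (inf'_eq_zero hσ hx0 hsupp hsub)]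
    exact ⟨hx0, ρ, hρ, hsupp, hsum⟩

open Classical in
-- At time one the smallest coordinate over `σ` has been used up, so the support loses a vertex of
-- `σ` and avoids both deleted faces. Points whose support does not contain `σ` have minimum zero
-- and do not move.
theorem push_one_mem_realization {K L : PreAbstractSimplicialComplex V} {σ : Finset V} {v : V}
    (hσ : σ.Nonempty) (hv : v ∉ σ) (h : K.IsFreePair σ (insert v σ))
    (hL : L.faces = K.faces \ {σ, insert v σ}) {x : V → ℝ} (hx : x ∈ K.realization) :
    push σ hσ v 1 x ∈ L.realization := by
  obtain ⟨hx0, ρ, hρ, hsupp, hsum⟩ := hx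
  by_cases hsub : σ ⊆ ρ
  · have hρτ : ρ ⊆ insert v σ := by
      rcases (h.subset_iff hρ).1 hsub with rfl | rfl
      · exact Finset.subset_insert _ _
      · exact subset_rfl
    -- `u` is a vertex of `σ` with the least coordinate; the new support lies in `τ` without `u`,
    -- which is neither `σ` nor `τ`.
    obtain ⟨u, hu, hmin⟩ := Finset.exists_mem_eq_inf' hσ x
    have huv : u ≠ v := fun e => hv (e ▸ hu)
    have hzero : push σ hσ v 1 x u = 0 := by simp [push, huv, hu, hmin]
    have hne : ((insert v σ).erase u).Nonempty := ⟨v, by simp [huv.symm]⟩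
    refine ⟨push_nonneg hσ hx0 zero_le_one le_rfl, (insert v σ).erase u, ?_, fun w hw => ?_, ?_⟩
    · rw [hL]
      refine ⟨(K.isRelLowerSet_faces h.2.1).2 (Finset.erase_subset _ _) hne, ?_⟩
      rintro (e | e)
      · have : u ∉ σ := by rw [← e]; simp
        exact this hu
      · have : u ∉ insert v σ := by rw [← e]; simp
        exact this (by simp [hu])
    · by_cases hwu : w = u
      · rw [hwu, hzero]
      · have hwv : w ≠ v := fun e => hw (by simp [e, huv.symm])
        have hwσ : w ∉ σ := fun e => hw (by simp [e, hwu])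
        have hwρ : w ∉ ρ := fun e => by simpa [hwv, hwσ] using hρτ e
        simp [push, hwv, hwσ, hsupp w hwρ]
    · rw [Finset.sum_erase _ hzero, sum_push hσ v, ← hsum]
      exact (Finset.sum_subset hρτ fun w _ hw => hsupp w hw).symm
  · rw [push_of_inf'_eq_zero hσ (inf'_eq_zero hσ hx0 hsupp hsub)]
    refine ⟨hx0, ρ, ?_, hsupp, hsum⟩
    rw [hL]
    refine ⟨hρ, ?_⟩
    rintro (rfl | rfl)
    · exact hsub subset_rfl
    · exact hsub (Finset.subset_insert _ _)

/-- An elementary collapse does not change the homotopy type of the realization. -/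
theorem ElementaryCollapse.nonempty_homotopyEquiv {K L : PreAbstractSimplicialComplex V}
    (h : ElementaryCollapse K L) :
    Nonempty (ContinuousMap.HomotopyEquiv K.realization L.realization) := by
  classical
  obtain ⟨σ, τ, hfree, hL⟩ := h
  have hσ : σ.Nonempty := (K.isRelLowerSet_faces hfree.1).1
  obtain ⟨v, hv, rfl⟩ := hfree.exists_eq_insert
  have hLK : L.realization ⊆ K.realization := by
    rintro x ⟨hx0, ρ, hρ, hx⟩
    rw [hL] at hρ
    exact ⟨hx0, ρ, hρ.1, hx⟩
  have hfix : ∀ x ∈ L.realization, ∀ s, push σ hσ v s x = x := by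
    rintro x ⟨hx0, ρ, hρ, hsupp, -⟩ s
    rw [hL] at hρ
    refine push_of_inf'_eq_zero hσ (inf'_eq_zero hσ hx0 hsupp fun hsub => hρ.2 ?_) v s
    exact (hfree.subset_iff hρ.1).1 hsub
  have hcont := continuous_push σ hσ v
  let r : C(K.realization, L.realization) :=
    ⟨fun x => ⟨push σ hσ v 1 x, push_one_mem_realization hσ hv hfree hL x.2⟩, by
      refine Continuous.subtype_mk ?_ _
      exact hcont.comp (continuous_const.prodMk continuous_subtype_val)⟩
  let i : C(L.realization, K.realization) :=
    ⟨fun x => ⟨x, hLK x.2⟩, Continuous.subtype_mk continuous_subtype_val _⟩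
  have hri : r.comp i = ContinuousMap.id _ := by
    ext x : 2
    exact hfix x x.2 1
  refine ⟨⟨r, i, ?_, ?_⟩⟩
  -- The push starts at the identity and ends at `i ∘ r`, so the homotopy obtained runs opposite to
  -- the one required.
  · refine ContinuousMap.Homotopic.symm ⟨⟨⟨fun p => ⟨push σ hσ v p.1 p.2,
      push_mem_realization hσ hv hfree p.1.2.1 p.1.2.2 p.2.2⟩, ?_⟩, ?_, ?_⟩⟩
    · refine Continuous.subtype_mk ?_ _
      exact hcont.comp ((continuous_subtype_val.comp continuous_fst).prodMk
        (continuous_subtype_val.comp continuous_snd))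
    · intro x
      exact Subtype.ext (push_zero σ hσ v x)
    · intro x
      rfl
  · rw [hri]

theorem contractibleSpace_iff_of_reflTransGen {K L : PreAbstractSimplicialComplex V}
    (h : Relation.ReflTransGen ElementaryCollapse K L) :
    ContractibleSpace K.realization ↔ ContractibleSpace L.realization := by
  induction h with
  | refl => rfl
  | tail _ hKL ih =>
    obtain ⟨e⟩ := hKL.nonempty_homotopyEquiv
    exact ih.trans ⟨fun _ => e.symm.contractibleSpace, fun _ => e.contractibleSpace⟩

/-- The realization of a single vertex is contractible. -/
theorem contractibleSpace_realization_of_faces_eq {K : PreAbstractSimplicialComplex V} {v : V}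
    (h : K.faces = {{v}}) : ContractibleSpace K.realization := by
  classical
  have hK : K.realization = {Pi.single v 1} := by
    ext x
    constructor
    · rintro ⟨-, ρ, hρ, hsupp, hsum⟩
      rw [h] at hρ
      obtain rfl : ρ = {v} := hρ
      ext w
      by_cases hw : w = v
      · subst hw; simpa using hsum
      · rw [hsupp w (by simpa using hw)]; simp [hw]
    · rintro rfl
      refine ⟨fun w => ?_, {v}, by simp [h], fun w hw => ?_, by simp⟩
      · by_cases hw : w = v
        · subst hw; simp
        · simp [hw]
      · rw [Finset.mem_singleton] at hw; simp [hw]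
  rw [hK]
  infer_instance

end Realization

end PreAbstractSimplicialComplex

namespace PreAbstractSimplicialComplex

/-! ### Face numbers, the Euler relation and the critical vertex -/

section Counting

variable {V : Type*}

theorem fVector_of_faces_eq_diff_singleton {d : ℕ} {K L : PreAbstractSimplicialComplex V}
    {σ : Finset V} {i : Fin (d + 1)} (hK : K.faces.Finite) (hσ : σ ∈ K.faces)
    (hi : σ.card = (i : ℕ) + 1) (hL : L.faces = K.faces \ {σ}) :
    K.fVector d = L.fVector d + Pi.single i 1 := by
  ext j
  rw [Pi.add_apply]
  unfold fVector
  by_cases hj : j = i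
  · subst hj
    have hset : {ρ | ρ ∈ K.faces ∧ ρ.card = (j : ℕ) + 1} =
        insert σ {ρ | ρ ∈ L.faces ∧ ρ.card = (j : ℕ) + 1} := by
      ext ρ
      simp only [hL, Set.mem_ofPred_eq, Set.mem_insert_iff, Set.mem_sdiff, Set.mem_singleton_iff]
      by_cases h : ρ = σ
      · subst h; simp [hσ, hi]
      · simp [h]
    rw [hset, Set.ncard_insert_of_notMem (by simp [hL]) ?_, Pi.single_eq_same]
    · exact hK.subset fun ρ hρ => by
        have := hρ.1
        rw [hL] at this
        exact this.1
  · rw [Pi.single_eq_of_ne hj, add_zero]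
    congr 1
    ext ρ
    simp only [hL, Set.mem_ofPred_eq, Set.mem_sdiff, Set.mem_singleton_iff]
    constructor
    · rintro ⟨h1, h2⟩
      refine ⟨⟨h1, ?_⟩, h2⟩
      rintro rfl
      exact hj (Fin.ext (by omega))
    · rintro ⟨h1, h2⟩
      exact ⟨h1.1, h2⟩

theorem IsFreePair.maximal {K : PreAbstractSimplicialComplex V} {σ τ : Finset V}
    (h : K.IsFreePair σ τ) : Maximal (fun ρ => ρ ∈ K.faces) τ := by
  refine ⟨h.2.1, fun ρ hρ hle => ?_⟩
  rw [h.2.2.2 ρ hρ (h.2.2.1.trans_subset hle)]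

/-- The complex left after the deletion of a maximal face. -/
def deleteFacet (K : PreAbstractSimplicialComplex V) (τ : Finset V)
    (h : Maximal (fun ρ => ρ ∈ K.faces) τ) : PreAbstractSimplicialComplex V where
  faces := K.faces \ {τ}
  isRelLowerSet_faces := by
    rintro σ ⟨hσ, hne⟩
    refine ⟨(K.isRelLowerSet_faces hσ).1, fun ρ hρσ hρ => ⟨?_, ?_⟩⟩
    · exact (K.isRelLowerSet_faces hσ).2 hρσ hρ
    · rintro rfl
      exact hne (Finset.Subset.antisymm (h.2 hσ hρσ) hρσ)

theorem IsFreePair.card_eq {K : PreAbstractSimplicialComplex V} {σ τ : Finset V}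
    (h : K.IsFreePair σ τ) : τ.card = σ.card + 1 := by
  classical
  obtain ⟨v, hv, rfl⟩ := h.exists_eq_insert
  exact Finset.card_insert_of_notMem hv

theorem fVector_of_isFreePair {d : ℕ} {K L : PreAbstractSimplicialComplex V}
    {σ τ : Finset V} (hK : K.faces.Finite) (h : K.IsFreePair σ τ)
    (hL : L.faces = K.faces \ {σ, τ}) (i j : Fin (d + 1)) (hi : σ.card = (i : ℕ) + 1)
    (hj : (j : ℕ) = i + 1) :
    K.fVector d = L.fVector d + Pi.single i 1 + Pi.single j 1 := by
  have hcard := h.card_eq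
  have h1 : K.fVector d = (K.deleteFacet τ h.maximal).fVector d + Pi.single j 1 :=
    fVector_of_faces_eq_diff_singleton hK h.2.1 (by omega) rfl
  rw [h1]
  congr 1
  refine fVector_of_faces_eq_diff_singleton (σ := σ) (hK.subset Set.sdiff_subset)
    ⟨h.1, h.2.2.1.ne⟩ hi ?_
  rw [hL]
  ext ρ
  simp [deleteFacet, not_or, and_assoc, and_comm]

theorem sum_neg_one_pow_add_single {d : ℕ} (f : Fin (d + 1) → ℕ) (i : Fin (d + 1)) :
    ∑ k : Fin (d + 1), (-1 : ℤ) ^ (k : ℕ) * ((f + Pi.single i 1 : Fin (d + 1) → ℕ) k : ℤ) =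
      ∑ k : Fin (d + 1), (-1 : ℤ) ^ (k : ℕ) * (f k : ℤ) + (-1) ^ (i : ℕ) := by
  have h : ∀ k : Fin (d + 1), (-1 : ℤ) ^ (k : ℕ) * ((f + Pi.single i 1 : Fin (d + 1) → ℕ) k : ℤ) =
      (-1 : ℤ) ^ (k : ℕ) * (f k : ℤ) + if k = i then (-1 : ℤ) ^ (k : ℕ) else 0 := by
    intro k
    by_cases hk : k = i
    · subst hk; simp [mul_add]
    · simp [hk]
  simp only [h, Finset.sum_add_distrib, Finset.sum_ite_eq', Finset.mem_univ, if_true]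

/-- A discrete Morse vector has the same alternating sum as the face vector. -/
theorem Deconstructs.euler {d : ℕ} {K : PreAbstractSimplicialComplex V} {c : Fin (d + 1) → ℕ}
    (h : K.Deconstructs c) (hfin : K.faces.Finite) (hdim : ∀ σ ∈ K.faces, σ.card ≤ d + 1) :
    ∑ i : Fin (d + 1), (-1 : ℤ) ^ (i : ℕ) * (K.fVector d i : ℤ) =
      ∑ i : Fin (d + 1), (-1 : ℤ) ^ (i : ℕ) * (c i : ℤ) := by
  induction h with
  | empty K hK => simp [fVector, hK]
  | collapse K L c hKL _ ih =>
    obtain ⟨σ, τ, hfree, hL⟩ := hKL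
    have hsub : L.faces ⊆ K.faces := hL ▸ Set.sdiff_subset
    rw [← ih (hfin.subset hsub) fun ρ hρ => hdim ρ (hsub hρ)]
    have hpos : 0 < σ.card := (K.isRelLowerSet_faces hfree.1).1.card_pos
    have hτ := hdim τ hfree.2.1
    have hcard := hfree.card_eq
    rw [fVector_of_isFreePair hfin hfree hL ⟨σ.card - 1, by omega⟩ ⟨σ.card, by omega⟩
      (by simp only; omega) (by simp only; omega), sum_neg_one_pow_add_single,
      sum_neg_one_pow_add_single]
    -- The two deleted faces have dimensions `m` and `m + 1`, so their signs cancel.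
    obtain ⟨m, hm⟩ := Nat.exists_eq_succ_of_ne_zero hpos.ne'
    simp [hm, pow_succ]
  | critical K L c σ i hσ hi hL _ ih =>
    have hsub : L.faces ⊆ K.faces := hL ▸ Set.sdiff_subset
    rw [fVector_of_faces_eq_diff_singleton hfin hσ.1 hi hL, sum_neg_one_pow_add_single,
      sum_neg_one_pow_add_single, ih (hfin.subset hsub) fun ρ hρ => hdim ρ (hsub hρ)]

theorem Deconstructs.of_reflTransGen {d : ℕ} {K L : PreAbstractSimplicialComplex V}
    {c : Fin (d + 1) → ℕ} (h : Relation.ReflTransGen ElementaryCollapse K L)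
    (hL : L.Deconstructs c) : K.Deconstructs c := by
  induction h using Relation.ReflTransGen.head_induction_on with
  | refl => exact hL
  | head hab _ ih => exact .collapse _ _ _ hab ih

theorem deconstructs_of_faces_eq_singleton {d : ℕ} {K : PreAbstractSimplicialComplex V} {v : V}
    (h : K.faces = {{v}}) : K.Deconstructs (Pi.single 0 1 : Fin (d + 1) → ℕ) := by
  have hmax : Maximal (fun ρ => ρ ∈ K.faces) {v} := by
    rw [h]
    exact ⟨rfl, fun ρ hρ _ => (show ρ = {v} from hρ).le⟩
  have := Deconstructs.critical (d := d) K (K.deleteFacet {v} hmax) 0 {v} 0 hmax (by simp) rfl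
    (.empty _ (by simp [deleteFacet, h]))
  simpa using this

/-- A nonempty complex cannot be deconstructed without deleting a critical vertex. -/
theorem Deconstructs.one_le_zero {d : ℕ} {K : PreAbstractSimplicialComplex V}
    {c : Fin (d + 1) → ℕ} (h : K.Deconstructs c) (hne : K.faces.Nonempty) : 1 ≤ c 0 := by
  induction h with
  | empty K hK => simp [hK] at hne
  | collapse K L c hKL _ ih =>
    obtain ⟨σ, τ, hfree, hL⟩ := hKL
    obtain ⟨v, hv⟩ := (K.isRelLowerSet_faces hfree.1).1
    -- A collapse never empties the complex: if the free face is a vertex, the other end of the edge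
    -- survives, otherwise `{v}` does.
    by_cases hσ : σ = {v}
    · subst hσ
      classical
      obtain ⟨w, hw, rfl⟩ := hfree.exists_eq_insert
      refine ih ⟨{w}, ?_⟩
      rw [hL]
      refine ⟨(K.isRelLowerSet_faces hfree.2.1).2 (by simp) (by simp), ?_⟩
      rintro (e | e)
      · exact hw (by rw [← e]; simp)
      · have : v ∈ ({w} : Finset V) := by rw [e]; simp
        exact hw (by simpa [eq_comm] using this)
    · refine ih ⟨{v}, ?_⟩
      rw [hL]
      refine ⟨(K.isRelLowerSet_faces hfree.1).2 (by simpa using hv) (by simp), ?_⟩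
      rintro (e | e)
      · exact hσ e.symm
      · have hlt := Finset.card_lt_card hfree.2.2.1
        rw [← show {v} = τ from e, Finset.card_singleton] at hlt
        have := Finset.card_pos.2 ⟨v, hv⟩
        omega
  | critical K L c σ i hσ hi hL _ ih =>
    by_cases hLne : L.faces.Nonempty
    · exact (ih hLne).trans (by simp)
    · obtain ⟨v, hv⟩ := (K.isRelLowerSet_faces hσ.1).1
      have hvK : {v} ∈ K.faces :=
        (K.isRelLowerSet_faces hσ.1).2 (by simpa using hv) (by simp)
      have hσv : {v} = σ := by
        by_contra hne'
        exact hLne ⟨{v}, by rw [hL]; exact ⟨hvK, hne'⟩⟩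
      have hi0 : i = 0 := by
        rw [← hσv, Finset.card_singleton] at hi
        exact Fin.ext (by rw [Fin.val_zero]; omega)
      subst hi0
      simp

end Counting

end PreAbstractSimplicialComplex

namespace PreAbstractSimplicialComplex

/-! ### Chains modulo two under deconstruction -/

section Chains

variable {V : Type*} [DecidableEq V]

/-- Finite sets of faces are chains over the field with two elements, with `symmDiff` as addition.
The parity of the number of members above `e` is the coefficient of `e` in the boundary, and it is
additive. -/
theorem odd_card_filter_symmDiff {α : Type*} [DecidableEq α] (p : α → Prop) [DecidablePred p]
    (A B : Finset α) :
    Odd ((symmDiff A B).filter p).card ↔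
      ¬ (Odd (A.filter p).card ↔ Odd (B.filter p).card) := by
  have h1 : (symmDiff A B).filter p = (A.filter p \ B.filter p) ∪ (B.filter p \ A.filter p) := by
    ext x
    simp only [Finset.mem_filter, Finset.mem_symmDiff, Finset.mem_union, Finset.mem_sdiff]
    tauto
  have h2 : Disjoint (A.filter p \ B.filter p) (B.filter p \ A.filter p) := disjoint_sdiff_sdiff
  rw [h1, Finset.card_union_of_disjoint h2]
  have h3 := Finset.card_sdiff_add_card_inter (A.filter p) (B.filter p)
  have h4 := Finset.card_sdiff_add_card_inter (B.filter p) (A.filter p)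
  rw [Finset.inter_comm] at h4
  rw [← h3, ← h4]
  simp only [Nat.odd_iff]
  omega

/-- The boundary of a simplex has zero boundary modulo two. -/
theorem even_card_filter_powersetCard {ρ e : Finset V} {n : ℕ} (hρ : ρ.card = n + 2)
    (he : e.card = n) : Even ((ρ.powersetCard (n + 1)).filter (e ⊆ ·)).card := by
  by_cases hsub : e ⊆ ρ
  · have h : (ρ.powersetCard (n + 1)).filter (e ⊆ ·) = (ρ \ e).image ρ.erase := by
      ext τ
      simp only [Finset.mem_filter, Finset.mem_powersetCard, Finset.mem_image, Finset.mem_sdiff]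
      constructor
      · rintro ⟨⟨hτρ, hτ⟩, heτ⟩
        have hone : (ρ \ τ).card = 1 := by rw [Finset.card_sdiff_of_subset hτρ]; omega
        obtain ⟨x, hx⟩ := Finset.card_eq_one.1 hone
        have hxm : x ∈ ρ \ τ := by rw [hx]; simp
        rw [Finset.mem_sdiff] at hxm
        refine ⟨x, ⟨hxm.1, fun h => hxm.2 (heτ h)⟩, ?_⟩
        rw [← Finset.sdiff_singleton_eq_erase, ← hx, Finset.sdiff_sdiff_eq_self hτρ]
      · rintro ⟨x, ⟨hx, hxe⟩, rfl⟩
        refine ⟨⟨Finset.erase_subset _ _, ?_⟩, Finset.subset_erase.2 ⟨hsub, hxe⟩⟩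
        rw [Finset.card_erase_of_mem hx]; omega
    rw [h, Finset.card_image_of_injOn ((Finset.erase_injOn ρ).mono (by simp)),
      Finset.card_sdiff_of_subset hsub]
    exact ⟨1, by omega⟩
  · rw [Finset.filter_false_of_mem]
    · simp
    · intro τ hτ heτ
      exact hsub (heτ.trans (Finset.mem_powersetCard.1 hτ).1)

theorem exists_ne_of_not_odd_card_filter {Z : Finset (Finset V)} {e τ : Finset V}
    (h : ¬ Odd (Z.filter (e ⊆ ·)).card) (hτ : τ ∈ Z) (he : e ⊆ τ) :
    ∃ τ' ∈ Z, τ' ≠ τ ∧ e ⊆ τ' := by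
  have hmem : τ ∈ Z.filter (e ⊆ ·) := Finset.mem_filter.2 ⟨hτ, he⟩
  have hpos := Finset.card_pos.2 ⟨τ, hmem⟩
  have hne : (Z.filter (e ⊆ ·)).card ≠ 1 := fun h1 => h (by rw [h1]; exact odd_one)
  obtain ⟨τ', h', hne'⟩ := Finset.exists_mem_ne (s := Z.filter (e ⊆ ·)) (by omega) τ
  exact ⟨τ', (Finset.mem_filter.1 h').1, hne', (Finset.mem_filter.1 h').2⟩

/-- A free face lies on no chain all of whose faces of that dimension have even degree. -/
theorem IsFreePair.notMem_of_not_odd {L : PreAbstractSimplicialComplex V} {σ τ : Finset V}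
    (h : L.IsFreePair σ τ) {Z : Finset (Finset V)} (hZ : ∀ ρ ∈ Z, ρ ∈ L.faces)
    (hcard : ∀ ρ ∈ Z, ρ.card = σ.card + 1)
    (hodd : ¬ Odd (Z.filter (σ ⊆ ·)).card) : τ ∉ Z := by
  intro hτ
  obtain ⟨τ', hτ', hne, hsub⟩ := exists_ne_of_not_odd_card_filter hodd hτ h.2.2.1.1
  refine hne (h.2.2.2 τ' (hZ _ hτ') (hsub.ssubset_of_ne ?_))
  rintro rfl
  have := hcard _ hτ'
  omega

/-- If `L` has a discrete Morse vector without critical triangles, then every two-dimensional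
cycle modulo two bounds. -/
theorem Deconstructs.exists_filling {L : PreAbstractSimplicialComplex V} {c : Fin 4 → ℕ}
    (h : L.Deconstructs c) (hc : c 2 = 0) (Z : Finset (Finset V))
    (hZ : ∀ τ ∈ Z, τ ∈ L.faces ∧ τ.card = 3)
    (hcycle : ∀ e : Finset V, e.card = 2 → ¬ Odd (Z.filter (e ⊆ ·)).card) :
    ∃ C : Finset (Finset V), (∀ ρ ∈ C, ρ ∈ L.faces ∧ ρ.card = 4) ∧
      ∀ τ : Finset V, τ.card = 3 → (Odd (C.filter (τ ⊆ ·)).card ↔ τ ∈ Z) := by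
  induction h generalizing Z with
  | empty K hK =>
    refine ⟨∅, by simp, fun τ _ => ?_⟩
    simp only [Finset.filter_empty, Finset.card_empty, Nat.not_odd_zero, false_iff]
    intro hτ
    simpa [hK] using (hZ τ hτ).1
  | collapse K L c hKL _ ih =>
    obtain ⟨σ, τ, hfree, hL⟩ := hKL
    have hsub : L.faces ⊆ K.faces := hL ▸ Set.sdiff_subset
    have hcard := hfree.card_eq
    -- A cycle through the free triangle is moved off it by adding the boundary of `τ`; a filling of
    -- the new cycle together with `τ` then fills the old one.
    by_cases hσZ : σ ∈ Z
    · have hσ3 := (hZ σ hσZ).2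
      have hτ4 : τ.card = 2 + 2 := by omega
      obtain ⟨C, hC, hbd⟩ := ih hc (symmDiff Z (τ.powersetCard 3)) (fun ρ hρ => by
          have hρ3 : ρ.card = 3 := by
            rcases Finset.mem_symmDiff.1 hρ with h | h
            · exact (hZ ρ h.1).2
            · exact (Finset.mem_powersetCard.1 h.1).2
          refine ⟨?_, hρ3⟩
          rw [hL]
          refine ⟨?_, ?_⟩
          · rcases Finset.mem_symmDiff.1 hρ with h | h
            · exact (hZ ρ h.1).1
            · exact (K.isRelLowerSet_faces hfree.2.1).2 (Finset.mem_powersetCard.1 h.1).1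
                (Finset.card_pos.1 (by omega))
          · rintro (rfl | rfl)
            · have : ρ ∈ τ.powersetCard 3 := Finset.mem_powersetCard.2 ⟨hfree.2.2.1.1, hσ3⟩
              rw [Finset.mem_symmDiff] at hρ
              tauto
            · omega) (fun e he => by
          have := Nat.not_odd_iff_even.2 (even_card_filter_powersetCard hτ4 he)
          have := hcycle e he
          rw [odd_card_filter_symmDiff]
          tauto)
      have hτC : τ ∉ C := fun h => by
        have := (hC τ h).1
        rw [hL] at this
        exact this.2 (by simp)
      refine ⟨insert τ C, fun ρ hρ => ?_, fun ρ hρ => ?_⟩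
      · rcases Finset.mem_insert.1 hρ with rfl | hρ
        · exact ⟨hfree.2.1, hτ4⟩
        · exact ⟨hsub (hC ρ hρ).1, (hC ρ hρ).2⟩
      · have hb := hbd ρ hρ
        rw [Finset.mem_symmDiff, Finset.mem_powersetCard] at hb
        rw [Finset.filter_insert]
        split_ifs with hρτ
        · rw [Finset.card_insert_of_notMem (by simp [hτC]), Nat.odd_add_one]
          tauto
        · tauto
    · obtain ⟨C, hC, hbd⟩ := ih hc Z (fun ρ hρ => by
        refine ⟨?_, (hZ ρ hρ).2⟩
        rw [hL]
        refine ⟨(hZ ρ hρ).1, ?_⟩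
        rintro (rfl | rfl)
        · exact hσZ hρ
        · have h3 := (hZ ρ hρ).2
          exact hfree.notMem_of_not_odd (fun ρ hρ => (hZ ρ hρ).1)
            (fun ρ hρ => by rw [(hZ ρ hρ).2]; omega) (hcycle σ (by omega)) hρ) hcycle
      exact ⟨C, fun ρ hρ => ⟨hsub (hC ρ hρ).1, (hC ρ hρ).2⟩, hbd⟩
  | critical K L c σ i hσ hi hL _ ih =>
    have hsub : L.faces ⊆ K.faces := hL ▸ Set.sdiff_subset
    rw [Pi.add_apply, Nat.add_eq_zero_iff] at hc
    have hi2 : i ≠ 2 := by rintro rfl; simp at hc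
    obtain ⟨C, hC, hbd⟩ := ih hc.1 Z (fun ρ hρ => by
      refine ⟨?_, (hZ ρ hρ).2⟩
      rw [hL]
      refine ⟨(hZ ρ hρ).1, ?_⟩
      rintro rfl
      have := (hZ ρ hρ).2
      exact hi2 (Fin.ext (by simp; omega))) hcycle
    exact ⟨C, fun ρ hρ => ⟨hsub (hC ρ hρ).1, (hC ρ hρ).2⟩, hbd⟩

/-- A complex that can be deconstructed without critical tetrahedra has no three-dimensional
cycles modulo two. -/
theorem Deconstructs.eq_empty_of_cycle {L : PreAbstractSimplicialComplex V} {c : Fin 4 → ℕ}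
    (h : L.Deconstructs c) (hc : c 3 = 0) (hdim : ∀ ρ ∈ L.faces, ρ.card ≤ 4)
    {C : Finset (Finset V)} (hC : ∀ ρ ∈ C, ρ ∈ L.faces ∧ ρ.card = 4)
    (hcycle : ∀ τ : Finset V, τ.card = 3 → ¬ Odd (C.filter (τ ⊆ ·)).card) : C = ∅ := by
  induction h with
  | empty K hK =>
    refine Finset.eq_empty_of_forall_notMem fun ρ hρ => ?_
    simpa [hK] using (hC ρ hρ).1
  | collapse K L c hKL _ ih =>
    obtain ⟨σ, τ, hfree, hL⟩ := hKL
    have hsub : L.faces ⊆ K.faces := hL ▸ Set.sdiff_subset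
    have hcard := hfree.card_eq
    refine ih hc (fun ρ hρ => hdim ρ (hsub hρ)) fun ρ hρ => ⟨?_, (hC ρ hρ).2⟩
    rw [hL]
    refine ⟨(hC ρ hρ).1, ?_⟩
    rintro (rfl | rfl)
    -- A free tetrahedron would need a face with five vertices above it.
    · have := hdim τ hfree.2.1
      have := (hC ρ hρ).2
      omega
    · have h4 := (hC ρ hρ).2
      exact hfree.notMem_of_not_odd (fun ρ hρ => (hC ρ hρ).1)
        (fun ρ hρ => by rw [(hC ρ hρ).2]; omega) (hcycle σ (by omega)) hρ
  | critical K L c σ i hσ hi hL _ ih =>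
    have hsub : L.faces ⊆ K.faces := hL ▸ Set.sdiff_subset
    rw [Pi.add_apply, Nat.add_eq_zero_iff] at hc
    have hi3 : i ≠ 3 := by rintro rfl; simp at hc
    refine ih hc.1 (fun ρ hρ => hdim ρ (hsub hρ)) fun ρ hρ => ⟨?_, (hC ρ hρ).2⟩
    rw [hL]
    refine ⟨(hC ρ hρ).1, ?_⟩
    rintro rfl
    have := (hC ρ hρ).2
    exact hi3 (Fin.ext (by simp; omega))

/-- Without three-dimensional cycles, a critical tetrahedron forces a critical triangle. -/
theorem Deconstructs.three_eq_zero {L : PreAbstractSimplicialComplex V} {c : Fin 4 → ℕ}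
    (h : L.Deconstructs c) (hc : c 2 = 0)
    (hcycle : ∀ C : Finset (Finset V), (∀ ρ ∈ C, ρ ∈ L.faces ∧ ρ.card = 4) →
      (∀ τ : Finset V, τ.card = 3 → ¬ Odd (C.filter (τ ⊆ ·)).card) → C = ∅) : c 3 = 0 := by
  induction h with
  | empty K hK => rfl
  | collapse K L c hKL _ ih =>
    obtain ⟨σ, τ, hfree, hL⟩ := hKL
    have hsub : L.faces ⊆ K.faces := hL ▸ Set.sdiff_subset
    exact ih hc fun C hC => hcycle C fun ρ hρ => ⟨hsub (hC ρ hρ).1, (hC ρ hρ).2⟩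
  | critical K L c σ i hσ hi hL hdec ih =>
    have hsub : L.faces ⊆ K.faces := hL ▸ Set.sdiff_subset
    rw [Pi.add_apply, Nat.add_eq_zero_iff] at hc
    have h3 := ih hc.1 fun C hC => hcycle C fun ρ hρ => ⟨hsub (hC ρ hρ).1, (hC ρ hρ).2⟩
    rw [Pi.add_apply, h3, zero_add]
    refine Pi.single_eq_of_ne ?_ _
    rintro rfl
    have hσ4 : σ.card = 2 + 2 := by simpa using hi
    -- The boundary of the critical tetrahedron stays in `L`, where it bounds a chain `C`; then `C`
    -- together with `σ` is a nonzero 3-cycle of `K`.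
    obtain ⟨C, hC, hbd⟩ := hdec.exists_filling hc.1 (σ.powersetCard 3) (fun τ hτ => by
        obtain ⟨hτσ, hτ3⟩ := Finset.mem_powersetCard.1 hτ
        refine ⟨?_, hτ3⟩
        rw [hL]
        refine ⟨(K.isRelLowerSet_faces hσ.1).2 hτσ (Finset.card_pos.1 (by omega)), ?_⟩
        rintro rfl
        omega) fun e he => Nat.not_odd_iff_even.2 (even_card_filter_powersetCard hσ4 he)
    have hσC : σ ∉ C := fun h => by
      have := (hC σ h).1
      rw [hL] at this
      exact this.2 rfl
    refine Finset.insert_ne_empty σ C (hcycle _ (fun ρ hρ => ?_) fun τ hτ => ?_)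
    · rcases Finset.mem_insert.1 hρ with rfl | hρ
      · exact ⟨hσ.1, hσ4⟩
      · exact ⟨hsub (hC ρ hρ).1, (hC ρ hρ).2⟩
    · have hb := hbd τ hτ
      rw [Finset.mem_powersetCard] at hb
      rw [Finset.filter_insert]
      split_ifs with hρτ
      · rw [Finset.card_insert_of_notMem (by simp [hσC]), Nat.odd_add_one]
        tauto
      · tauto

end Chains

/-! ### Why critical triangles are unavoidable -/

section Obstruction

variable {V ι : Type*} [DecidableEq V]

/-- Triangles of the block with base triangle `s` and set of tetrahedra `C`. -/
def IsBlockTriangle (s : Finset V) (C : Set (Finset V)) (τ : Finset V) : Prop :=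
  τ.card = 3 ∧ (τ = s ∨ ∃ ρ ∈ C, τ ⊆ ρ)

/-- A family of blocks in `K`, each consisting of a base triangle `s i` and of tetrahedra `C i`,
such that the base triangles form a complex without free edges and each block meets the rest
of `K` in its base triangle only and has no other free triangle. -/
structure IsBlockFamily (K : PreAbstractSimplicialComplex V) (s : ι → Finset V)
    (C : ι → Set (Finset V)) : Prop where
  base_mem : ∀ i, s i ∈ K.faces
  base_card : ∀ i, (s i).card = 3
  mem : ∀ i, ∀ ρ ∈ C i, ρ ∈ K.faces
  card : ∀ i, ∀ ρ ∈ C i, ρ.card = 4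
  exists_edge : ∀ i e, e ⊆ s i → e.card = 2 → ∃ j ≠ i, e ⊆ s j
  disjoint : ∀ i j τ, IsBlockTriangle (s i) (C i) τ → IsBlockTriangle (s j) (C j) τ → i = j
  mem_of_subset : ∀ i τ ρ, IsBlockTriangle (s i) (C i) τ → τ ≠ s i → ρ ∈ K.faces →
    ρ.card = 4 → τ ⊆ ρ → ρ ∈ C i
  exists_ne : ∀ i, ∀ ρ ∈ C i, ∀ τ ⊆ ρ, τ.card = 3 → τ ≠ s i → ∃ ρ' ∈ C i, ρ' ≠ ρ ∧ τ ⊆ ρ'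
  -- For an empty block this says that the base triangle lies in no tetrahedron of `K`.
  exists_base : ∀ i, ∀ ρ ∈ K.faces, ρ.card = 4 → s i ⊆ ρ → ∃ ρ' ∈ C i, s i ⊆ ρ'

/-- In the subcomplex `L` each base triangle is replaced by a chain of its block with the same
boundary, and only the blocks whose base triangle is gone have been entered. -/
structure IsBlockChain (L : PreAbstractSimplicialComplex V) (s : ι → Finset V)
    (C : ι → Set (Finset V)) (D : ι → Finset (Finset V)) : Prop where
  mem : ∀ i, ∀ τ ∈ D i, τ ∈ L.faces
  isBlockTriangle : ∀ i, ∀ τ ∈ D i, IsBlockTriangle (s i) (C i) τ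
  odd_iff : ∀ i (e : Finset V), e.card = 2 → (Odd ((D i).filter (e ⊆ ·)).card ↔ e ⊆ s i)
  eq_singleton : ∀ i, s i ∈ L.faces → D i = {s i}
  subset : ∀ i, s i ∈ L.faces → ∀ ρ ∈ C i, ρ ∈ L.faces

variable {K L M : PreAbstractSimplicialComplex V} {s : ι → Finset V} {C : ι → Set (Finset V)}
  {D : ι → Finset (Finset V)}

theorem IsBlockFamily.isBlockChain (h : IsBlockFamily K s C) :
    IsBlockChain K s C fun i => {s i} where
  mem i τ hτ := by rw [Finset.mem_singleton.1 hτ]; exact h.base_mem i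
  isBlockTriangle i τ hτ := by
    rw [Finset.mem_singleton.1 hτ]; exact ⟨h.base_card i, Or.inl rfl⟩
  odd_iff i e _ := by
    rw [Finset.filter_singleton]
    split_ifs with he <;> simp [he]
  eq_singleton _ _ := rfl
  subset i _ := h.mem i

/-- An edge outside `s i` has even degree in `D i`, so a second triangle of `D i` contains it. An
edge of `s i` also lies in another base triangle `s j` and hence has odd, so positive, degree in `D
j`. Consequently no chain triangle can be removed through a free edge. -/
theorem IsBlockFamily.exists_ne_of_chain (h : IsBlockFamily K s C) (hD : IsBlockChain L s C D)
    {i : ι} {τ e : Finset V} (hτ : τ ∈ D i) (he : e ⊆ τ) (hcard : e.card = 2) :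
    ∃ j, ∃ τ' ∈ D j, τ' ≠ τ ∧ e ⊆ τ' := by
  by_cases hes : e ⊆ s i
  · obtain ⟨j, hj, hej⟩ := h.exists_edge i e hes hcard
    have hpos := ((hD.odd_iff j e hcard).2 hej).pos
    obtain ⟨τ', hτ'⟩ := Finset.card_pos.1 hpos
    rw [Finset.mem_filter] at hτ'
    refine ⟨j, τ', hτ'.1, ?_, hτ'.2⟩
    rintro rfl
    exact hj (h.disjoint j i τ' (hD.isBlockTriangle j _ hτ'.1) (hD.isBlockTriangle i _ hτ))
  · obtain ⟨τ', h'⟩ :=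
      exists_ne_of_not_odd_card_filter (fun h => hes ((hD.odd_iff i e hcard).1 h)) hτ he
    exact ⟨i, τ', h'⟩

/-- The same chains serve in a subcomplex that contains them, if no new block is entered. -/
theorem IsBlockChain.mono (hD : IsBlockChain L s C D) (hML : M.faces ⊆ L.faces)
    (hmem : ∀ i, ∀ τ ∈ D i, τ ∈ M.faces)
    (hsub : ∀ i, s i ∈ M.faces → ∀ ρ ∈ C i, ρ ∈ M.faces) : IsBlockChain M s C D where
  mem := hmem
  isBlockTriangle := hD.isBlockTriangle
  odd_iff := hD.odd_iff
  eq_singleton i hi := hD.eq_singleton i (hML hi)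
  subset := hsub

/-- Only a collapse through a free triangle `σ` of some `D i` affects the chains. It removes a
tetrahedron `τ` of the same block, and adding the boundary of `τ` to `D i` moves the chain off `σ`
without changing its boundary. -/
theorem IsBlockFamily.exists_chain_of_collapse (h : IsBlockFamily K s C) (hLK : L.faces ⊆ K.faces)
    (hdim : ∀ ρ ∈ K.faces, ρ.card ≤ 4) (hD : IsBlockChain L s C D)
    (hLM : ElementaryCollapse L M) : ∃ D', IsBlockChain M s C D' := by
  obtain ⟨σ, τ, hfree, hM⟩ := hLM
  have hML : M.faces ⊆ L.faces := hM ▸ Set.sdiff_subset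
  have hcard := hfree.card_eq
  have hσpos := (L.isRelLowerSet_faces hfree.1).1.card_pos
  have hτ4 := hdim τ (hLK hfree.2.1)
  have hsurv : ∀ ρ ∈ L.faces, ρ ≠ σ → ρ ≠ τ → ρ ∈ M.faces := by
    intro ρ hρ h1 h2
    rw [hM]
    exact ⟨hρ, by rintro (e | e); exacts [h1 e, h2 e]⟩
  by_cases hσ3 : σ.card = 3
  · have hτ4' : τ.card = 2 + 2 := by omega
    -- While the base triangle is present its whole block is, and every other triangle of a block
    -- tetrahedron lies in a second one. So the block can be entered only through its base.
    have hblock : ∀ i, s i ∈ L.faces → τ ∈ C i → σ = s i := by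
      intro i hi hτC
      by_contra hne
      obtain ⟨ρ', hρ', hne', hsub⟩ := h.exists_ne i τ hτC σ hfree.2.2.1.1 hσ3 hne
      refine hne' (hfree.2.2.2 ρ' (hD.subset i hi ρ' hρ') (hsub.ssubset_of_ne ?_))
      rintro rfl
      have := h.card i _ hρ'
      omega
    have hsub : ∀ i, s i ∈ M.faces → ∀ ρ ∈ C i, ρ ∈ M.faces := by
      intro i hi ρ hρ
      refine hsurv ρ (hD.subset i (hML hi) ρ hρ) ?_ ?_
      · rintro rfl
        have := h.card i _ hρ
        omega
      · rintro rfl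
        have := hblock i (hML hi) hρ
        rw [← this, hM] at hi
        exact hi.2 (by simp)
    have hτD : ∀ i, τ ∉ D i := fun i hi => by
      have := (hD.isBlockTriangle i τ hi).1
      omega
    by_cases hσD : ∃ i, σ ∈ D i
    · obtain ⟨i, hi⟩ := hσD
      have htri := hD.isBlockTriangle i σ hi
      -- If `σ` is the base, a block tetrahedron above it is still present and must be `τ` by
      -- uniqueness; otherwise all tetrahedra of `K` above `σ` belong to the block.
      have hτC : τ ∈ C i := by
        by_cases hσs : σ = s i
        · obtain ⟨ρ', hρ', hsub'⟩ :=
            h.exists_base i τ (hLK hfree.2.1) hτ4' (hσs ▸ hfree.2.2.1.1)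
          have : ρ' = τ := by
            refine hfree.2.2.2 ρ' (hD.subset i (hσs ▸ hfree.1) ρ' hρ') ?_
            rw [hσs]
            refine hsub'.ssubset_of_ne fun e => ?_
            have h1 := h.card i _ hρ'
            have h2 := h.base_card i
            rw [e] at h2
            omega
          exact this ▸ hρ'
        · exact h.mem_of_subset i σ τ htri hσs (hLK hfree.2.1) hτ4' hfree.2.2.1.1
      have hsi : s i ∉ M.faces := by
        intro hmem
        have heq := hD.eq_singleton i (hML hmem)
        rw [heq, Finset.mem_singleton] at hi
        rw [← hi, hM] at hmem
        exact hmem.2 (by simp)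
      have hother : ∀ j, j ≠ i → σ ∉ D j := fun j hj hσj =>
        hj (h.disjoint j i σ (hD.isBlockTriangle j _ hσj) htri)
      classical
      refine ⟨Function.update D i (symmDiff (D i) (τ.powersetCard 3)), ?_, ?_, ?_, ?_, hsub⟩
      · intro j ρ hρ
        by_cases hj : j = i
        · subst hj
          rw [Function.update_self] at hρ
          refine hsurv ρ ?_ ?_ ?_
          · rcases Finset.mem_symmDiff.1 hρ with h' | h'
            · exact hD.mem j ρ h'.1
            · obtain ⟨h1, h2⟩ := Finset.mem_powersetCard.1 h'.1
              exact (L.isRelLowerSet_faces hfree.2.1).2 h1 (Finset.card_pos.1 (by omega))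
          · rintro rfl
            have : ρ ∈ τ.powersetCard 3 := Finset.mem_powersetCard.2 ⟨hfree.2.2.1.1, hσ3⟩
            rw [Finset.mem_symmDiff] at hρ
            tauto
          · rintro rfl
            rcases Finset.mem_symmDiff.1 hρ with h' | h'
            · exact hτD _ h'.1
            · have := (Finset.mem_powersetCard.1 h'.1).2
              omega
        · rw [Function.update_of_ne hj] at hρ
          refine hsurv ρ (hD.mem j ρ hρ) ?_ ?_
          · rintro rfl; exact hother j hj hρ
          · rintro rfl; exact hτD j hρ
      · intro j ρ hρ
        by_cases hj : j = i
        · subst hj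
          rw [Function.update_self] at hρ
          rcases Finset.mem_symmDiff.1 hρ with h' | h'
          · exact hD.isBlockTriangle j ρ h'.1
          · obtain ⟨h1, h2⟩ := Finset.mem_powersetCard.1 h'.1
            exact ⟨h2, Or.inr ⟨τ, hτC, h1⟩⟩
        · rw [Function.update_of_ne hj] at hρ
          exact hD.isBlockTriangle j ρ hρ
      · intro j e he
        by_cases hj : j = i
        · subst hj
          rw [Function.update_self, odd_card_filter_symmDiff, hD.odd_iff j e he]
          have := Nat.not_odd_iff_even.2 (even_card_filter_powersetCard hτ4' he)
          tauto
        · rw [Function.update_of_ne hj]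
          exact hD.odd_iff j e he
      · intro j hj
        have hji : j ≠ i := by rintro rfl; exact hsi hj
        rw [Function.update_of_ne hji]
        exact hD.eq_singleton j (hML hj)
    · refine ⟨D, hD.mono hML (fun i ρ hρ => hsurv ρ (hD.mem i ρ hρ) ?_ ?_) hsub⟩
      · rintro rfl; exact hσD ⟨i, hρ⟩
      · rintro rfl; exact hτD i hρ
  · refine ⟨D, hD.mono hML (fun i ρ hρ => hsurv ρ (hD.mem i ρ hρ) ?_ ?_) fun i hi ρ hρ =>
      hsurv ρ (hD.subset i (hML hi) ρ hρ) ?_ ?_⟩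
    · rintro rfl
      exact hσ3 (hD.isBlockTriangle i ρ hρ).1
    · rintro rfl
      have := (hD.isBlockTriangle i ρ hρ).1
      obtain ⟨j, τ', hτ', hne, hsub⟩ :=
        h.exists_ne_of_chain hD hρ hfree.2.2.1.1 (by omega : σ.card = 2)
      refine hne (hfree.2.2.2 τ' (hD.mem j τ' hτ') (hsub.ssubset_of_ne ?_))
      rintro rfl
      exact hσ3 (hD.isBlockTriangle j σ hτ').1
    · rintro rfl
      have := h.card i _ hρ
      omega
    · rintro rfl
      have := h.card i _ hρ
      omega

/-- Critical faces here have at most two vertices, so they touch neither chains nor blocks. The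
chains would persist in the empty complex, although each is nonempty because its boundary is. -/
theorem IsBlockFamily.not_deconstructs_of_chain [Nonempty ι] (h : IsBlockFamily K s C)
    (hdim : ∀ ρ ∈ K.faces, ρ.card ≤ 4) {c : Fin 4 → ℕ} (hdec : L.Deconstructs c)
    (hc2 : c 2 = 0) (hc3 : c 3 = 0) (hLK : L.faces ⊆ K.faces) (hD : IsBlockChain L s C D) :
    False := by
  induction hdec generalizing D with
  | empty L hL =>
    obtain ⟨i⟩ := ‹Nonempty ι›
    obtain ⟨e, he, hcard⟩ := Finset.exists_subset_card_eq (s := s i) (n := 2)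
      (by rw [h.base_card i]; omega)
    obtain ⟨τ, hτ⟩ := Finset.card_pos.1 ((hD.odd_iff i e hcard).2 he).pos
    have := hD.mem i τ (Finset.mem_filter.1 hτ).1
    rw [hL] at this
    exact this
  | collapse L M c hLM _ ih =>
    obtain ⟨D', hD'⟩ := h.exists_chain_of_collapse hLK hdim hD hLM
    obtain ⟨σ, τ, -, hM⟩ := hLM
    exact ih hc2 hc3 ((hM ▸ Set.sdiff_subset).trans hLK) hD'
  | critical L M c σ i hσ hi hM _ ih =>
    have hML : M.faces ⊆ L.faces := hM ▸ Set.sdiff_subset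
    rw [Pi.add_apply, Nat.add_eq_zero_iff] at hc2 hc3
    have hi2 : i ≠ 2 := by rintro rfl; simp at hc2
    have hi3 : i ≠ 3 := by rintro rfl; simp at hc3
    have hcard : σ.card ≤ 2 := by
      have h2 : (i : ℕ) ≠ 2 := fun e => hi2 (Fin.ext e)
      have h3 : (i : ℕ) ≠ 3 := fun e => hi3 (Fin.ext e)
      omega
    have hsurv : ∀ ρ ∈ L.faces, 3 ≤ ρ.card → ρ ∈ M.faces := by
      intro ρ hρ h3
      rw [hM]
      refine ⟨hρ, ?_⟩
      rintro rfl
      omega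
    refine ih hc2.1 hc3.1 (hML.trans hLK) (hD.mono hML (fun i ρ hρ => ?_) fun i hi ρ hρ => ?_)
    · exact hsurv ρ (hD.mem i ρ hρ) (hD.isBlockTriangle i ρ hρ).1.ge
    · exact hsurv ρ (hD.subset i (hML hi) ρ hρ) (by rw [h.card i ρ hρ]; omega)

/-- A complex with a block family cannot be deconstructed without critical triangles. -/
theorem IsBlockFamily.one_le_two [Nonempty ι] (h : IsBlockFamily K s C)
    (hdim : ∀ ρ ∈ K.faces, ρ.card ≤ 4) {c c' : Fin 4 → ℕ} (hc' : K.Deconstructs c')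
    (hc'3 : c' 3 = 0) (hc : K.Deconstructs c) : 1 ≤ c 2 := by
  by_contra hlt
  have hc2 : c 2 = 0 := by omega
  -- The other deconstruction, without critical tetrahedra, supplies the absence of 3-cycles.
  have hc3 : c 3 = 0 := hc.three_eq_zero hc2 fun _ => hc'.eq_empty_of_cycle hc'3 hdim
  exact h.not_deconstructs_of_chain hdim hc hc2 hc3 subset_rfl h.isBlockChain

end Obstruction

end PreAbstractSimplicialComplex

/-! ### Search trees for kernel computation -/

/-- Unbalanced binary search trees of natural numbers. -/
inductive SearchTree where
  | leaf : SearchTree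
  | node : SearchTree → ℕ → SearchTree → SearchTree

namespace SearchTree

/-- Membership, by the recursor itself since this evaluates faster in the kernel. -/
noncomputable def mem (n : ℕ) (t : SearchTree) : Bool :=
  t.rec false fun _ k _ l r => (n.ble k).rec r ((k.ble n).rec l true)

noncomputable def insert (n : ℕ) (t : SearchTree) : SearchTree :=
  t.rec (node leaf n leaf) fun l k r l' r' =>
    (n.ble k).rec (node l k r') ((k.ble n).rec (node l' k r) (node l k r))

noncomputable def all (p : ℕ → Bool) (t : SearchTree) : Bool :=
  t.rec true fun _ k _ l r => p k && (l && r)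

/-- Translates the recursor-based branching used for evaluation into `if`, with which proofs can
work. -/
theorem rec_ble {α : Type*} (a b : α) (m n : ℕ) :
    (Bool.rec a b (m.ble n) : α) = if m ≤ n then b else a := by
  split_ifs with h
  · rw [Nat.ble_eq_true_of_le h]
  · rw [Bool.eq_false_iff.2 fun h' => h (Nat.le_of_ble_eq_true h')]

theorem mem_leaf (n : ℕ) : leaf.mem n = false := rfl

theorem mem_node (n k : ℕ) (l r : SearchTree) :
    (node l k r).mem n = if n ≤ k then if k ≤ n then true else l.mem n else r.mem n := by
  rw [← rec_ble, ← rec_ble]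
  rfl

theorem insert_leaf (n : ℕ) : leaf.insert n = node leaf n leaf := rfl

theorem insert_node (n k : ℕ) (l r : SearchTree) :
    (node l k r).insert n = if n ≤ k then if k ≤ n then node l k r else node (l.insert n) k r
      else node l k (r.insert n) := by
  rw [← rec_ble, ← rec_ble]
  rfl

theorem mem_insert (n m : ℕ) (t : SearchTree) :
    (t.insert n).mem m = true ↔ m = n ∨ t.mem m = true := by
  induction t with
  | leaf =>
    rw [insert_leaf, mem_node]
    simp only [mem_leaf]
    split_ifs with h1 h2
    · simp; omega
    · simp; omega
    · simp; omega
  | node l k r ihl ihr =>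
    rw [insert_node, mem_node]
    split_ifs with h1 h2 h3 h4 h5 h6 h7 h8 <;> simp only [mem_node] <;> split_ifs <;>
      simp_all <;> omega

theorem all_node (p : ℕ → Bool) (k : ℕ) (l r : SearchTree) :
    (node l k r).all p = (p k && (l.all p && r.all p)) := rfl

theorem of_all {p : ℕ → Bool} {t : SearchTree} (h : t.all p = true) {n : ℕ}
    (hn : t.mem n = true) : p n = true := by
  induction t with
  | leaf => simp [mem_leaf] at hn
  | node l k r ihl ihr =>
    simp only [all_node, Bool.and_eq_true] at h
    rw [mem_node] at hn
    split_ifs at hn with h1 h2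
    · exact le_antisymm h1 h2 ▸ h.1
    · exact ihl h.2.1 hn
    · exact ihr h.2.2 hn

end SearchTree

/-! ### Faces as bit masks -/

/-- The bit mask of a finite set of natural numbers. -/
def mask (s : Finset ℕ) : ℕ := ∑ i ∈ s, 2 ^ i

theorem mask_injective : Function.Injective mask := fun s t h => by
  rw [← Finset.toFinset_bitIndices_sum_two_pow s, ← Finset.toFinset_bitIndices_sum_two_pow t]
  exact congrArg (fun n : ℕ => n.bitIndices.toFinset) h

theorem mask_erase {s : Finset ℕ} {w : ℕ} (hw : w ∈ s) : mask (s.erase w) = mask s - 2 ^ w := by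
  have := Finset.sum_erase_add s (fun i => 2 ^ i) hw
  unfold mask
  omega

def listMask : List ℕ → ℕ
  | [] => 0
  | v :: l => 2 ^ v + listMask l

theorem mask_toFinset {l : List ℕ} (h : l.Nodup) : mask l.toFinset = listMask l := by
  induction l with
  | nil => rfl
  | cons v l ih =>
    rw [List.nodup_cons] at h
    rw [List.toFinset_cons, mask, Finset.sum_insert (by simpa using h.1), listMask, ← ih h.2, mask]

theorem testBit_mask {s : Finset ℕ} {i : ℕ} : (mask s).testBit i = true ↔ i ∈ s := by
  rw [← Nat.mem_bitIndices, ← List.mem_toFinset, mask, Finset.toFinset_bitIndices_sum_two_pow]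

/-- Bit masks contained in `m`; all of them if `m` has at most as many bits as the first
argument says. -/
def submasks : ℕ → ℕ → List ℕ
  | 0, _ => [0]
  | k + 1, m =>
    -- `m &&& (m - 1)` clears the lowest bit of `m`, and the `^^^` isolates that bit.
    submasks k (m &&& (m - 1)) ++ (submasks k (m &&& (m - 1))).map (· ||| (m ^^^ (m &&& (m - 1))))

theorem testBit_of_mem_submasks {k m n i : ℕ} (h : n ∈ submasks k m) (hi : n.testBit i = true) :
    m.testBit i = true := by
  induction k generalizing m n with
  | zero => simp_all [submasks]
  | succ k ih =>
    rw [submasks, List.mem_append, List.mem_map] at h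
    rcases h with h | ⟨n', h, rfl⟩
    · have := ih h hi
      rw [Nat.testBit_and, Bool.and_eq_true] at this
      exact this.1
    · rw [Nat.testBit_or, Bool.or_eq_true, Nat.testBit_xor] at hi
      rcases hi with hi | hi
      · have := ih h hi
        rw [Nat.testBit_and, Bool.and_eq_true] at this
        exact this.1
      · rw [Nat.testBit_and] at hi
        revert hi
        cases m.testBit i <;> simp

/-- An injection that spreads out the masks, in order to keep the search trees shallow. -/
def scramble (n : ℕ) : ℕ :=
  -- The multiplier is odd, hence invertible modulo `2 ^ 128`, and close to `2 ^ 128` divided by the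
  -- golden ratio, as in Fibonacci hashing. The first summand only serves injectivity on all of `ℕ`.
  n / 2 ^ 128 * 2 ^ 128 + n * 0x9E3779B97F4A7C15F39CC0605CEDC835 % 2 ^ 128

theorem div_mul_add_mul_mod_injective {M c : ℕ} (hM : 0 < M) (hc : M.Coprime c) :
    Function.Injective fun n => n / M * M + n * c % M := fun m n h => by
  have hm := Nat.mod_lt (m * c) hM
  have hn := Nat.mod_lt (n * c) hM
  have h1 : m / M = n / M := by
    have := congrArg (· / M) h
    simpa [Nat.add_comm, Nat.add_mul_div_right, hM, Nat.div_eq_of_lt hm, Nat.div_eq_of_lt hn]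
      using this
  have h2 : m * c ≡ n * c [MOD M] := by
    have := congrArg (· % M) h
    simpa [Nat.add_comm, Nat.ModEq] using this
  have h3 : m % M = n % M := Nat.ModEq.cancel_right_of_coprime hc h2
  rw [← Nat.div_add_mod m M, ← Nat.div_add_mod n M, h1, h3]

theorem scramble_injective : Function.Injective scramble :=
  div_mul_add_mul_mod_injective (by norm_num) (by norm_num)

def nodupBool : List ℕ → Bool
  | [] => true
  | v :: l => l.all (fun w => !(v.beq w)) && nodupBool l

theorem nodup_of_nodupBool {l : List ℕ} (h : nodupBool l = true) : l.Nodup := by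
  induction l with
  | nil => exact List.nodup_nil
  | cons v l ih =>
    simp only [nodupBool, Bool.and_eq_true, List.all_eq_true, Bool.not_eq_true'] at h
    refine List.nodup_cons.2 ⟨fun hv => ?_, ih h.2⟩
    have := h.1 v hv
    simp at this

/-! ### Deconstructions read backwards and their verification -/

/-- A step in the construction of a complex: `pair (v :: l)` adds the faces `l` and `v :: l`, the
former being free afterwards, and `critical l` adds the face `l`. -/
inductive BuildStep where
  | pair : List ℕ → BuildStep
  | critical : List ℕ → BuildStep

namespace BuildStep

/-- Performs a step on the set of masks of the faces, if it is admissible. -/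
noncomputable def apply (t : SearchTree) : BuildStep → Option SearchTree
  | pair [] => none
  | pair (v :: l) =>
    bif !l.isEmpty && (nodupBool (v :: l) && (!(t.mem (scramble (listMask l))) &&
      l.all fun w => t.mem (scramble (listMask (v :: l) - 2 ^ w))))
    then some ((t.insert (scramble (listMask l))).insert (scramble (listMask (v :: l)))) else none
  | critical l =>
    bif !l.isEmpty && (nodupBool l && (!(t.mem (scramble (listMask l))) &&
      (l.length.beq 1 || l.all fun w => t.mem (scramble (listMask l - 2 ^ w)))))
    then some (t.insert (scramble (listMask l))) else none

noncomputable def run : List BuildStep → SearchTree → Option SearchTree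
  | [], t => some t
  | x :: xs, t => match x.apply t with
    | none => none
    | some t' => run xs t'

/-- The face vector of the faces added by a step. -/
def faceVector (d : ℕ) : BuildStep → Fin (d + 1) → ℕ
  | pair l, i => if l.length = i + 1 ∨ l.length = i + 2 then 1 else 0
  | critical l, i => if l.length = i + 1 then 1 else 0

/-- The vector counting the critical faces added by a step. -/
def morseVector (d : ℕ) : BuildStep → Fin (d + 1) → ℕ
  | pair _, _ => 0
  | critical l, i => if l.length = i + 1 then 1 else 0

def length : BuildStep → ℕ
  | pair l => l.length
  | critical l => l.length

end BuildStep

namespace PreAbstractSimplicialComplex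

/-- The set of scrambled masks `t` describes the complex `K`. -/
def IsRepresentedBy (K : PreAbstractSimplicialComplex ℕ) (t : SearchTree) : Prop :=
  ∀ σ, σ ∈ K.faces ↔ t.mem (scramble (mask σ)) = true

theorem IsRepresentedBy.faces_subset {K L : PreAbstractSimplicialComplex ℕ} {t u : SearchTree}
    (hK : K.IsRepresentedBy t) (hL : L.IsRepresentedBy u)
    (h : (t.all fun n => u.mem n) = true) : K.faces ⊆ L.faces :=
  fun σ hσ => (hL σ).2 (SearchTree.of_all h ((hK σ).1 hσ))

theorem IsRepresentedBy.insert {K L : PreAbstractSimplicialComplex ℕ} {t : SearchTree}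
    {σ : Finset ℕ} (hK : K.IsRepresentedBy t) (hL : L.faces = insert σ K.faces) :
    L.IsRepresentedBy (t.insert (scramble (mask σ))) := by
  intro ρ
  rw [SearchTree.mem_insert, hL, Set.mem_insert_iff, hK ρ,
    scramble_injective.eq_iff, mask_injective.eq_iff]

/-- The complex obtained by adding a face whose proper faces are present. -/
def addFace {V : Type*} [DecidableEq V] (K : PreAbstractSimplicialComplex V) (σ : Finset V)
    (hσ : σ.Nonempty) (h : ∀ w ∈ σ, (σ.erase w).Nonempty → σ.erase w ∈ K.faces) :
    PreAbstractSimplicialComplex V where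
  faces := insert σ K.faces
  isRelLowerSet_faces := by
    rintro τ (rfl | hτ)
    · refine ⟨hσ, fun ρ hρ hne => ?_⟩
      rcases hρ.eq_or_ssubset with e | hlt
      · exact Or.inl e
      · obtain ⟨w, hw, hwρ⟩ := Finset.exists_of_ssubset hlt
        have hsub : ρ ⊆ τ.erase w := Finset.subset_erase.2 ⟨hρ, hwρ⟩
        exact Or.inr ((K.isRelLowerSet_faces (h w hw (hne.mono hsub))).2 hsub hne)
    · refine ⟨(K.isRelLowerSet_faces hτ).1, fun ρ hρ hne => ?_⟩
      exact Or.inr ((K.isRelLowerSet_faces hτ).2 hρ hne)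

theorem faces_eq_insert_diff_singleton {V : Type*} {K : PreAbstractSimplicialComplex V}
    {σ : Finset V} (h : σ ∉ K.faces) : K.faces = insert σ K.faces \ {σ} := by
  ext ρ
  simp only [Set.mem_sdiff, Set.mem_insert_iff, Set.mem_singleton_iff]
  constructor
  · intro hρ
    exact ⟨Or.inr hρ, by rintro rfl; exact h hρ⟩
  · rintro ⟨hρ | hρ, hne⟩
    · exact absurd hρ hne
    · exact hρ

/-- `L` arises from `K` by a sequence of steps, each adding a free pair or a maximal face. -/
inductive Builds : PreAbstractSimplicialComplex ℕ → List BuildStep →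
    PreAbstractSimplicialComplex ℕ → Prop
  | nil (K : PreAbstractSimplicialComplex ℕ) : Builds K [] K
  | pair (K L M : PreAbstractSimplicialComplex ℕ) (l : List ℕ) (xs : List BuildStep)
      (σ τ : Finset ℕ) (h : L.IsFreePair σ τ) (hl : τ.card = l.length)
      (hK : K.faces = L.faces \ {σ, τ}) (hM : Builds L xs M) : Builds K (.pair l :: xs) M
  | critical (K L M : PreAbstractSimplicialComplex ℕ) (l : List ℕ) (xs : List BuildStep)
      (σ : Finset ℕ) (h : Maximal (fun ρ => ρ ∈ L.faces) σ) (hl : σ.card = l.length)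
      (hK : K.faces = L.faces \ {σ}) (hM : Builds L xs M) : Builds K (.critical l :: xs) M

theorem exists_maximal_of_apply {K : PreAbstractSimplicialComplex ℕ} {t u : SearchTree}
    {l : List ℕ} (hK : K.IsRepresentedBy t) (h : BuildStep.apply t (.critical l) = some u) :
    ∃ (L : PreAbstractSimplicialComplex ℕ) (σ : Finset ℕ), L.IsRepresentedBy u ∧
      Maximal (fun ρ => ρ ∈ L.faces) σ ∧ σ.card = l.length ∧ K.faces = L.faces \ {σ} := by
  rw [BuildStep.apply, cond_eq_ite] at h
  split_ifs at h with hc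
  simp only [Bool.and_eq_true, Bool.not_eq_true', List.isEmpty_eq_false_iff, Bool.or_eq_true,
    Nat.beq_eq, List.all_eq_true] at hc
  obtain ⟨hne, hnodup, hmem, hfac⟩ := hc
  have hnd := nodup_of_nodupBool hnodup
  have hcard : l.toFinset.card = l.length := List.toFinset_card_of_nodup hnd
  have hnotMem : l.toFinset ∉ K.faces := by
    rw [hK, mask_toFinset hnd, hmem]
    simp
  let L := K.addFace l.toFinset (List.toFinset_nonempty_iff _ |>.2 hne) fun w hw hwne => by
    rcases hfac with h1 | h1
    · have := Finset.card_erase_of_mem hw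
      have := hwne.card_pos
      omega
    · rw [hK, mask_erase hw, mask_toFinset hnd]
      exact h1 w (List.mem_toFinset.1 hw)
  refine ⟨L, l.toFinset, ?_, ⟨Or.inl rfl, ?_⟩, hcard, faces_eq_insert_diff_singleton hnotMem⟩
  · rw [← Option.some.inj h, ← mask_toFinset hnd]
    exact hK.insert rfl
  · rintro ρ (rfl | hρ) hle
    · exact le_rfl
    · exact absurd ((K.isRelLowerSet_faces hρ).2 hle (List.toFinset_nonempty_iff _ |>.2 hne))
        hnotMem

/-- The few tests suffice by closure under faces. Since `l` is absent, so is every face above it,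
which makes `l` free once `v :: l` is added; and the proper faces of `l` lie in faces of `v :: l`
already checked to be present. -/
theorem exists_isFreePair_of_apply {K : PreAbstractSimplicialComplex ℕ} {t u : SearchTree}
    {l : List ℕ} (hK : K.IsRepresentedBy t) (h : BuildStep.apply t (.pair l) = some u) :
    ∃ (L : PreAbstractSimplicialComplex ℕ) (σ τ : Finset ℕ), L.IsRepresentedBy u ∧
      L.IsFreePair σ τ ∧ τ.card = l.length ∧ K.faces = L.faces \ {σ, τ} := by
  cases l with
  | nil => simp [BuildStep.apply] at h
  | cons v l =>
  rw [BuildStep.apply, cond_eq_ite] at h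
  split_ifs at h with hc
  simp only [Bool.and_eq_true, Bool.not_eq_true', List.isEmpty_eq_false_iff,
    List.all_eq_true] at hc
  obtain ⟨hne, hnodup, hmem, hfac⟩ := hc
  have hnd := nodup_of_nodupBool hnodup
  have hnd' := (List.nodup_cons.1 hnd).2
  have hv : v ∉ l.toFinset := by simpa using (List.nodup_cons.1 hnd).1
  have hcard : (v :: l).toFinset.card = (v :: l).length := List.toFinset_card_of_nodup hnd
  have hσne : l.toFinset.Nonempty := List.toFinset_nonempty_iff _ |>.2 hne
  have hσ : l.toFinset ∉ K.faces := by
    rw [hK, mask_toFinset hnd', hmem]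
    simp
  have hface : ∀ w ∈ l, (v :: l).toFinset.erase w ∈ K.faces := fun w hw => by
    rw [hK, mask_erase (by simp [hw]), mask_toFinset hnd]
    exact hfac w hw
  have hτ : (v :: l).toFinset ∉ K.faces := fun hτ =>
    hσ ((K.isRelLowerSet_faces hτ).2 (by rw [List.toFinset_cons]; exact Finset.subset_insert _ _)
      hσne)
  let L₁ := K.addFace l.toFinset hσne fun w hw hwne =>
    (K.isRelLowerSet_faces (hface w (List.mem_toFinset.1 hw))).2
      (Finset.erase_subset_erase _ (by rw [List.toFinset_cons]; exact Finset.subset_insert _ _))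
      hwne
  let L := L₁.addFace (v :: l).toFinset (by simp) fun w hw _ => by
    by_cases hwv : w = v
    · subst hwv
      rw [List.toFinset_cons, Finset.erase_insert hv]
      exact Or.inl rfl
    · exact Or.inr (hface w (by simpa [hwv] using hw))
  have hlt : l.toFinset ⊂ (v :: l).toFinset := by
    rw [List.toFinset_cons]
    exact Finset.ssubset_insert hv
  have hτ₁ : (v :: l).toFinset ∉ L₁.faces := by
    rintro (e | e)
    · exact hlt.ne e.symm
    · exact hτ e
  refine ⟨L, l.toFinset, (v :: l).toFinset, ?_, ⟨Or.inr (Or.inl rfl), Or.inl rfl, hlt, ?_⟩,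
    hcard, ?_⟩
  · rw [← Option.some.inj h, ← mask_toFinset hnd, ← mask_toFinset hnd']
    exact (hK.insert (L := L₁) rfl).insert rfl
  · rintro ρ (e | e | hρ) hsub
    · exact e
    · exact absurd e.symm hsub.ne
    · exact absurd ((K.isRelLowerSet_faces hρ).2 hsub.1 hσne) hσ
  · have h1 : L₁.faces = L.faces \ {(v :: l).toFinset} := faces_eq_insert_diff_singleton hτ₁
    have h2 : K.faces = L₁.faces \ {l.toFinset} := faces_eq_insert_diff_singleton hσ
    rw [h2, h1, sdiff_sdiff]
    congr 1
    exact Set.pair_comm _ _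

/-- An admissible sequence of steps constructs a complex. -/
theorem exists_builds_of_run {K : PreAbstractSimplicialComplex ℕ} {t u : SearchTree}
    {xs : List BuildStep} (hK : K.IsRepresentedBy t) (h : BuildStep.run xs t = some u) :
    ∃ L : PreAbstractSimplicialComplex ℕ, L.IsRepresentedBy u ∧ Builds K xs L := by
  induction xs generalizing K t with
  | nil =>
    rw [BuildStep.run] at h
    exact ⟨K, Option.some.inj h ▸ hK, .nil K⟩
  | cons x xs ih =>
    rw [BuildStep.run] at h
    split at h
    · simp at h
    · rename_i t' ht'
      cases x with
      | pair l =>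
        obtain ⟨L, σ, τ, hL, hfree, hcard, hdiff⟩ := exists_isFreePair_of_apply hK ht'
        obtain ⟨M, hM, hLM⟩ := ih hL h
        exact ⟨M, hM, .pair K L M l xs σ τ hfree hcard hdiff hLM⟩
      | critical l =>
        obtain ⟨L, σ, hL, hmax, hcard, hdiff⟩ := exists_maximal_of_apply hK ht'
        obtain ⟨M, hM, hLM⟩ := ih hL h
        exact ⟨M, hM, .critical K L M l xs σ hmax hcard hdiff hLM⟩

theorem Builds.finite {K L : PreAbstractSimplicialComplex ℕ} {xs : List BuildStep}
    (h : Builds K xs L) (hK : K.faces.Finite) : L.faces.Finite := by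
  induction h with
  | nil K => exact hK
  | pair K L M l xs σ τ hfree _ hdiff _ ih =>
    refine ih (hK.union (Set.toFinite {σ, τ}) |>.subset fun ρ hρ => ?_)
    rw [hdiff]
    by_cases h : ρ ∈ ({σ, τ} : Set _)
    · exact Or.inr h
    · exact Or.inl ⟨hρ, h⟩
  | critical K L M l xs σ _ _ hdiff _ ih =>
    refine ih (hK.union (Set.toFinite {σ}) |>.subset fun ρ hρ => ?_)
    rw [hdiff]
    by_cases h : ρ ∈ ({σ} : Set _)
    · exact Or.inr h
    · exact Or.inl ⟨hρ, h⟩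

theorem Builds.reflTransGen {K L : PreAbstractSimplicialComplex ℕ} {xs : List BuildStep}
    (h : Builds K xs L) (hxs : ∀ x ∈ xs, ∃ l, x = .pair l) :
    Relation.ReflTransGen ElementaryCollapse L K := by
  induction h with
  | nil K => exact .refl
  | pair K L M l xs σ τ hfree _ hdiff _ ih =>
    exact (ih fun x hx => hxs x (by simp [hx])).tail ⟨σ, τ, hfree, hdiff⟩
  | critical K L M l xs σ _ _ _ _ _ =>
    obtain ⟨l', hl'⟩ := hxs (.critical l) (by simp)
    simp at hl'

/-- Read backwards, an added pair is an elementary collapse and an added maximal face is a critical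
one; `c` accounts for what is left at the start. -/
theorem Builds.deconstructs {d : ℕ} {K L : PreAbstractSimplicialComplex ℕ} {xs : List BuildStep}
    {c : Fin (d + 1) → ℕ} (h : Builds K xs L) (hc : K.Deconstructs c)
    (hxs : ∀ x ∈ xs, x.length ≤ d + 1) :
    L.Deconstructs (c + (xs.map (BuildStep.morseVector d)).sum) := by
  induction h generalizing c with
  | nil K => simpa using hc
  | pair K L M l xs σ τ hfree _ hdiff _ ih =>
    have h0 : BuildStep.morseVector d (.pair l) = 0 := rfl
    rw [List.map_cons, List.sum_cons, h0, zero_add]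
    exact ih (.collapse L K c ⟨σ, τ, hfree, hdiff⟩ hc) fun x hx => hxs x (by simp [hx])
  | critical K L M l xs σ hmax hl hdiff _ ih =>
    have hle : l.length ≤ d + 1 := hxs (.critical l) (by simp)
    have hpos := (L.isRelLowerSet_faces hmax.1).1.card_pos
    have hsingle : BuildStep.morseVector d (.critical l) =
        Pi.single ⟨l.length - 1, by omega⟩ 1 := by
      ext i
      rw [BuildStep.morseVector, Pi.single_apply]
      exact if_congr (by rw [Fin.ext_iff]; simp only; omega) rfl rfl
    rw [List.map_cons, List.sum_cons, hsingle, ← add_assoc]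
    refine ih (.critical L K c σ _ hmax ?_ hdiff hc) fun x hx => hxs x (by simp [hx])
    simp only
    omega

theorem Builds.fVector {d : ℕ} {K L : PreAbstractSimplicialComplex ℕ} {xs : List BuildStep}
    (h : Builds K xs L) (hK : K.faces.Finite) (hxs : ∀ x ∈ xs, x.length ≤ d + 1) :
    L.fVector d = K.fVector d + (xs.map (BuildStep.faceVector d)).sum := by
  induction h with
  | nil K => simp
  | pair K L M l xs σ τ hfree hl hdiff _ ih =>
    have hL := (Builds.pair K L L l [] σ τ hfree hl hdiff (.nil L)).finite hK
    have hle : l.length ≤ d + 1 := hxs (.pair l) (by simp)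
    have hpos := (L.isRelLowerSet_faces hfree.1).1.card_pos
    have hcard := hfree.card_eq
    rw [ih hL fun x hx => hxs x (by simp [hx]), List.map_cons, List.sum_cons, ← add_assoc]
    congr 1
    rw [fVector_of_isFreePair hL hfree hdiff ⟨σ.card - 1, by omega⟩ ⟨σ.card, by omega⟩
      (by simp only; omega) (by simp only; omega), add_assoc]
    congr 1
    ext i
    rw [Pi.add_apply, Pi.single_apply, Pi.single_apply, BuildStep.faceVector]
    simp only [Fin.ext_iff]
    split_ifs <;> omega
  | critical K L M l xs σ hmax hl hdiff _ ih =>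
    have hL := (Builds.critical K L L l [] σ hmax hl hdiff (.nil L)).finite hK
    have hle : l.length ≤ d + 1 := hxs (.critical l) (by simp)
    have hpos := (L.isRelLowerSet_faces hmax.1).1.card_pos
    rw [ih hL fun x hx => hxs x (by simp [hx]), List.map_cons, List.sum_cons, ← add_assoc]
    congr 1
    rw [fVector_of_faces_eq_diff_singleton hL hmax.1 (i := ⟨l.length - 1, by omega⟩)
      (by simp only; omega) hdiff]
    congr 1
    ext i
    rw [Pi.single_apply, BuildStep.faceVector]
    exact if_congr (by rw [Fin.ext_iff]; simp only; omega) rfl rfl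

/-- The complex without faces. -/
def emptyComplex (V : Type*) : PreAbstractSimplicialComplex V where
  faces := ∅
  isRelLowerSet_faces := by simp [IsRelLowerSet]

theorem emptyComplex_isRepresentedBy :
    (emptyComplex ℕ).IsRepresentedBy .leaf := fun σ => by
  simp [emptyComplex, SearchTree.mem_leaf]

/-- The complex with one vertex. -/
def vertexComplex {V : Type*} (v : V) : PreAbstractSimplicialComplex V where
  faces := {{v}}
  isRelLowerSet_faces := by
    rintro σ rfl
    refine ⟨by simp, fun ρ hρ hne => ?_⟩
    exact (Finset.subset_singleton_iff.1 hρ).resolve_left hne.ne_empty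

theorem vertexComplex_isRepresentedBy (v : ℕ) :
    (vertexComplex v).IsRepresentedBy (SearchTree.leaf.insert (scramble (2 ^ v))) := fun σ => by
  have h : scramble (2 ^ v) = scramble (mask {v}) := by simp [mask]
  rw [SearchTree.mem_insert, h, scramble_injective.eq_iff, mask_injective.eq_iff]
  simp [vertexComplex, SearchTree.mem_leaf]

end PreAbstractSimplicialComplex

/-! ### Explicit construction sequences -/

namespace TwoOptima

/-- The pairs that build a copy of `Σ₃` from the cone with apex `h` over the boundary of `p q r`. -/
def copyTop (p q r a b c d e f g h i : ℕ) : List (List ℕ) :=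
  [[h, c], [h, e], [h, g], [q, f], [e, d], [c, i], [c, b], [h, a], [h, q, a], [q, r, a],
   [h, p, e], [h, r, c], [h, p, a], [h, r, g], [h, c, g], [h, c, e], [p, a, e], [r, a, g],
   [h, q, g], [h, q, e], [r, a, c], [a, p, g], [q, f, g], [a, r, e], [q, e, f], [c, g, i],
   [c, r, b], [e, c, d], [e, p, d], [c, e, i], [a, q, c], [r, b, g], [h, e, g], [e, r, i],
   [r, p, c], [c, b, i], [p, r, d], [p, q, d], [p, a, d], [r, q, b], [g, p, i], [c, d, i],
   [g, p, f], [q, a, f], [g, f, i], [r, a, b], [c, q, i], [r, p, b], [e, r, f], [r, p, c, h],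
   [q, r, a, h], [h, q, r, g], [h, p, r, a], [h, q, e, g], [r, p, a, c], [h, p, q, a],
   [h, c, e, g], [h, p, c, e], [r, q, a, g], [h, r, c, g], [h, p, q, e], [a, p, q, g],
   [a, q, r, c], [e, p, c, d], [r, b, c, g], [c, e, g, i], [a, p, q, c], [p, q, a, e],
   [q, e, f, g], [a, p, r, g], [a, q, r, e], [a, p, r, e], [e, q, r, f], [r, p, b, g],
   [g, e, f, i], [r, p, a, b], [p, q, c, d], [p, r, d, e], [p, q, a, d], [g, p, q, f],
   [r, q, b, c], [c, d, e, i], [p, r, a, d], [c, b, g, i], [r, q, a, b], [e, r, d, i],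
   [q, r, a, f], [a, q, r, d], [q, p, a, f], [g, p, f, i], [g, p, b, i], [a, p, q, b],
   [c, q, b, i], [c, q, d, i], [e, r, f, i], [a, p, r, f], [b, p, q, i], [d, q, r, i],
   [f, p, r, i], [i, p, q, r]]

/-- The pairs that build the cone with apex `h` over the edges `u v` and `u w`. -/
def conePairs (u v w h : ℕ) : List (List ℕ) := [[u, h], [u, v, h], [u, w, h]]

def copyTopFrom (p q r a : ℕ) : List (List ℕ) :=
  copyTop p q r a (a + 1) (a + 2) (a + 3) (a + 4) (a + 5) (a + 6) (a + 7) (a + 8)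

/-- The pairs that build the copy of `Σ₃` with free triangle `p q r` and first further vertex `a`
from the edges `u v` and `u w` of this triangle. -/
def copyPairs (u v w p q r a : ℕ) : List (List ℕ) :=
  conePairs u v w (a + 7) ++ [a + 7, v, w] :: copyTopFrom p q r a

/-- The pairs that build `Σ₂` from the vertex `1`, up to the pair formed by `1 2` and `3`. -/
def sigma2Pairs : List (List ℕ) :=
  [[1, 24], [24, 25], [24, 23], [24, 22], [25, 3], [24, 2], [24, 1, 22], [24, 2, 23], [24, 2, 22],
   [24, 1, 25], [24, 23, 25], [1, 22, 25], [2, 22, 23], [22, 2, 25], [25, 3, 23], [22, 1, 23],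
   [23, 1, 3], [25, 2, 3]]

/-- Pairs of a vertex and an edge of `Σ₃'`. -/
def sigma3ModifiedEdges : List (List ℕ) :=
  [[3, 15], [2, 5], [3, 19], [2, 6], [3, 8], [2, 18], [5, 9], [3, 20], [2, 17], [19, 21], [6, 10],
   [5, 13], [15, 14], [1, 16], [5, 12], [6, 4], [6, 11], [6, 7]]

/-- Pairs of an edge and a triangle of `Σ₃'`. -/
def sigma3ModifiedTriangles : List (List ℕ) :=
  [[5, 3, 12], [3, 4, 8], [3, 8, 15], [5, 2, 12], [5, 6, 13], [3, 4, 19], [3, 15, 20], [3, 4, 12],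
   [3, 2, 19], [3, 19, 20], [3, 2, 20], [8, 4, 15], [5, 1, 9], [20, 15, 19], [5, 6, 9],
   [2, 17, 20], [2, 18, 19], [2, 1, 17], [4, 12, 19], [6, 2, 13], [5, 3, 13], [2, 1, 12],
   [6, 2, 11], [3, 1, 15], [6, 2, 10], [15, 14, 19], [20, 17, 19], [5, 3, 9], [19, 15, 21],
   [1, 15, 16], [2, 3, 18], [3, 5, 8], [3, 13, 20], [2, 4, 18], [1, 4, 17], [6, 3, 7], [6, 4, 10],
   [2, 5, 11], [12, 1, 19], [20, 15, 17], [15, 3, 14], [2, 1, 13], [6, 4, 9], [6, 2, 7],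
   [4, 2, 15], [19, 18, 21], [6, 4, 11], [1, 9, 16], [15, 16, 21], [3, 7, 14], [19, 17, 21],
   [4, 10, 17], [15, 2, 21], [2, 1, 18], [2, 1, 7], [4, 3, 17], [6, 4, 13], [5, 2, 8], [3, 4, 20],
   [19, 1, 21], [5, 2, 9], [2, 1, 11], [3, 4, 14], [19, 14, 21], [2, 5, 7], [18, 3, 21],
   [2, 5, 10], [3, 2, 14], [13, 1, 20], [19, 17, 18], [5, 1, 8], [4, 11, 18], [2, 1, 10],
   [15, 16, 17], [1, 2, 16], [9, 3, 16], [5, 3, 11], [6, 3, 10], [2, 6, 12], [6, 4, 7], [5, 6, 8],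
   [9, 4, 16], [3, 1, 14]]

/-- Pairs of a triangle and a tetrahedron of `Σ₃'`. -/
def sigma3ModifiedTetrahedra : List (List ℕ) :=
  [[2, 5, 6, 12], [5, 3, 6, 13], [5, 3, 6, 12], [2, 1, 5, 12], [2, 1, 6, 12], [6, 2, 5, 13],
   [6, 3, 4, 13], [3, 4, 6, 12], [2, 1, 6, 10], [2, 1, 6, 13], [2, 1, 5, 13], [5, 1, 3, 13],
   [2, 5, 6, 10], [3, 2, 4, 20], [3, 4, 13, 20], [6, 1, 4, 13], [13, 1, 4, 20], [2, 1, 5, 10],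
   [5, 1, 3, 8], [6, 3, 4, 10], [5, 3, 6, 8], [13, 1, 3, 20], [5, 2, 6, 8], [4, 1, 2, 20],
   [6, 1, 4, 12], [6, 3, 5, 10], [1, 2, 4, 17], [6, 1, 4, 10], [5, 1, 2, 8], [5, 1, 2, 9],
   [5, 2, 6, 9], [5, 1, 3, 12], [2, 1, 6, 7], [4, 3, 12, 19], [3, 2, 19, 20], [2, 1, 6, 9],
   [2, 1, 6, 8], [12, 1, 4, 19], [3, 1, 8, 15], [4, 1, 10, 17], [4, 2, 3, 17], [12, 1, 3, 19],
   [2, 1, 5, 7], [5, 3, 6, 9], [2, 1, 17, 20], [2, 1, 6, 11], [5, 1, 3, 10], [2, 5, 6, 11],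
   [5, 1, 3, 9], [6, 1, 4, 7], [8, 3, 4, 15], [4, 3, 10, 17], [20, 2, 17, 19], [6, 3, 4, 7],
   [3, 2, 4, 19], [2, 5, 6, 7], [20, 3, 15, 19], [3, 1, 15, 20], [3, 4, 6, 8], [6, 1, 4, 8],
   [4, 1, 2, 19], [2, 1, 5, 11], [5, 3, 6, 11], [6, 3, 5, 7], [6, 1, 4, 9], [8, 1, 4, 15],
   [5, 1, 3, 7], [20, 1, 15, 17], [9, 1, 4, 16], [3, 4, 7, 14], [3, 1, 7, 14], [4, 1, 2, 15],
   [20, 15, 17, 19], [6, 3, 4, 9], [15, 3, 14, 19], [4, 2, 3, 15], [19, 2, 17, 18],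
   [10, 1, 3, 17], [1, 2, 15, 16], [9, 3, 4, 16], [2, 3, 17, 18], [2, 3, 4, 18], [6, 1, 4, 11],
   [7, 1, 4, 14], [15, 1, 16, 17], [5, 1, 3, 11], [19, 14, 15, 21], [2, 1, 18, 19], [1, 2, 4, 16],
   [2, 1, 4, 18], [19, 17, 18, 21], [3, 1, 14, 19], [3, 2, 4, 14], [19, 15, 17, 21],
   [6, 3, 4, 11], [9, 1, 3, 16], [3, 2, 14, 15], [4, 1, 11, 18], [4, 3, 11, 18], [15, 2, 14, 21],
   [19, 1, 18, 21], [15, 2, 16, 21], [1, 3, 16, 17], [11, 1, 3, 18], [4, 2, 3, 16],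
   [19, 1, 14, 21], [18, 3, 17, 21], [4, 1, 2, 14], [15, 16, 17, 21], [17, 3, 16, 21],
   [18, 1, 3, 21], [16, 2, 3, 21], [14, 1, 2, 21]]

/-- The pairs that build `Σ₃'` with the copies of `Σ₃` from the edges `1 2` and `1 3`, up to the
pair formed by `2 3` and `78`. -/
def lowerPairs : List (List ℕ) :=
  sigma3ModifiedEdges ++ (copyPairs 2 1 5 1 2 5 26 ++ (copyPairs 2 1 6 1 2 6 35 ++
  (copyPairs 1 3 5 1 3 5 53 ++ (copyPairs 2 5 6 2 5 6 80 ++ (copyPairs 5 3 6 3 5 6 98 ++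
  (copyPairs 6 1 4 1 4 6 62 ++ (copyPairs 6 3 4 3 4 6 89 ++ (copyPairs 1 2 4 1 2 4 44 ++
  conePairs 4 2 3 78))))))))

/-- The pairs that follow the pair formed by `2 3` and `78`, up to the pair formed by `1 2 3`
and `21`. -/
def upperPairs : List (List ℕ) :=
  copyTopFrom 2 3 4 71 ++ (sigma3ModifiedTriangles ++ sigma3ModifiedTetrahedra)

/-- Builds the complex with a critical edge. -/
def stepsEdge : List BuildStep :=
  -- The edge `2 3` is already present from `Σ₂`, so its partner `78 2 3` becomes critical. As `1 2
  -- 3` is reserved for the final pair with `21 1 2 3`, the edge `1 2` has no partner either.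
  .critical [1] :: (sigma2Pairs.map .pair ++ .critical [1, 2] :: (lowerPairs.map .pair ++
  .critical [78, 2, 3] :: (upperPairs.map .pair ++ [.pair [21, 1, 2, 3]])))

/-- Builds the complex with a critical tetrahedron. -/
def stepsTetrahedron : List BuildStep :=
  -- Here `1 2` is paired with `1 2 3`, which leaves `21 1 2 3` without a partner.
  .critical [1] :: (sigma2Pairs.map .pair ++ .pair [3, 1, 2] :: (lowerPairs.map .pair ++
  .critical [78, 2, 3] :: (upperPairs.map .pair ++ [.critical [21, 1, 2, 3]])))

/-- Builds `Σ₃'` with the copies of `Σ₃` from the edges `1 2` and `1 3`. -/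
def ballPairs : List (List ℕ) :=
  lowerPairs ++ [78, 2, 3] :: (upperPairs ++ [[21, 1, 2, 3]])

/-- Extends the complex by the cone with apex `0` over `Σ₃'` with the copies of `Σ₃`. -/
def stepsCone : List BuildStep :=
  -- Joining `0` to both members of each pair that builds `B` from the vertex `1` gives a pair of
  -- new faces, since `B` itself is already present.
  .pair [1, 0] :: ([1, 2] :: [1, 3] :: ballPairs).map fun
    | [] => .pair []
    | v :: l => .pair (v :: 0 :: l)

/-- Builds the same complex from a vertex. -/
def stepsConed : List BuildStep :=
  -- After `Σ₂` and the cone over `1 2 3`, each remaining face of `B` is paired with its cone. The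
  -- filter drops the pairs for `2 3` and `1 2 3`, which are already present.
  (sigma2Pairs ++ [3, 1, 2] :: [1, 0] :: [1, 0, 2] :: [1, 0, 3] :: [1, 0, 2, 3] ::
    (ballPairs.flatMap fun l => [0 :: l.tail, 0 :: l]).filter fun l =>
      l ≠ [0, 2, 3] ∧ l ≠ [0, 1, 2, 3]).map .pair


/-! ### Comparison with the faces of `two_optima` -/

/-- Inserts the members of a list one by one. -/
noncomputable def _root_.SearchTree.insertAll (l : List ℕ) : SearchTree → SearchTree :=
  l.rec id fun n _ ih t => (t.mem n).rec (ih (t.insert n)) (ih t)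

theorem _root_.SearchTree.mem_insertAll {l : List ℕ} {t : SearchTree} {n : ℕ}
    (h : (t.insertAll l).mem n = true) : n ∈ l ∨ t.mem n = true := by
  induction l generalizing t with
  | nil => exact Or.inr h
  | cons m l ih =>
    change SearchTree.mem n ((t.mem m).rec ((t.insert m).insertAll l) (t.insertAll l)) = true at h
    rw [List.mem_cons]
    cases hm : t.mem m <;> rw [hm] at h
    · rcases ih h with h | h
      · tauto
      · rw [SearchTree.mem_insert] at h
        tauto
    · have := ih h
      tauto

/-- The scrambled masks of the subsets of the facets. -/
noncomputable def faceTree : SearchTree :=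
  SearchTree.leaf.insertAll (facets.flatMap fun f => (submasks 4 (mask f)).map scramble)

noncomputable def isFaceSet (t : SearchTree) : Bool :=
  facets.all (fun f => t.mem (scramble (mask f))) && t.all fun n => faceTree.mem n

theorem faces_eq_of_isFaceSet {K : PreAbstractSimplicialComplex ℕ} {t : SearchTree}
    (hK : K.IsRepresentedBy t) (h : isFaceSet t = true) : K.faces = twoOptima.faces := by
  rw [isFaceSet, Bool.and_eq_true, List.all_eq_true] at h
  ext σ
  constructor
  · intro hσ
    have hmem := SearchTree.of_all h.2 ((hK σ).1 hσ)
    rcases SearchTree.mem_insertAll hmem with hmem | hmem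
    · simp only [List.mem_flatMap, List.mem_map] at hmem
      obtain ⟨f, hf, n, hn, hnσ⟩ := hmem
      have hn' := scramble_injective hnσ
      -- `faceTree` also contains the mask `0` of the empty set, but faces of `K` are nonempty.
      refine ⟨(K.isRelLowerSet_faces hσ).1, f, hf, fun i hi => ?_⟩
      rw [← testBit_mask] at hi ⊢
      exact testBit_of_mem_submasks hn (hn' ▸ hi)
    · simp [SearchTree.mem_leaf] at hmem
  · rintro ⟨hne, f, hf, hsub⟩
    exact (K.isRelLowerSet_faces ((hK f).2 (h.1 f hf))).2 hsub hne

open BuildStep SearchTree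

set_option maxRecDepth 100000

noncomputable def checkEdge : Bool := match run stepsEdge leaf with
  | none => false
  | some t => isFaceSet t

noncomputable def checkTetrahedron : Bool := match run stepsTetrahedron leaf with
  | none => false
  | some t => isFaceSet t

noncomputable def checkCone : Bool := match run stepsEdge leaf with
  | none => false
  | some t => match run stepsCone t with
    | none => false
    | some u => match run stepsConed (leaf.insert (scramble (2 ^ 1))) with
      | none => false
      | some u' => (u.all fun n => u'.mem n) && u'.all fun n => u.mem n

end TwoOptima

/-! ### Both Morse vectors, the face vector and contractibility -/

namespace TwoOptima
open PreAbstractSimplicialComplex BuildStep SearchTree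

set_option maxRecDepth 100000

theorem checkEdge_eq_true : checkEdge = true := by decide +kernel

theorem checkTetrahedron_eq_true : checkTetrahedron = true := by decide +kernel

theorem checkCone_eq_true : checkCone = true := by decide +kernel

/-- The tree `t` is retained because `checkCone` continues from it. -/
theorem exists_builds_edge : ∃ (t : SearchTree) (K : PreAbstractSimplicialComplex ℕ),
    run stepsEdge leaf = some t ∧ K.IsRepresentedBy t ∧ Builds (emptyComplex ℕ) stepsEdge K ∧
      K.faces = twoOptima.faces := by
  have h := checkEdge_eq_true
  unfold checkEdge at h
  split at h
  · simp at h
  · rename_i t ht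
    obtain ⟨K, hK, hb⟩ := exists_builds_of_run emptyComplex_isRepresentedBy ht
    exact ⟨t, K, ht, hK, hb, faces_eq_of_isFaceSet hK h⟩

theorem builds_edge : Builds (emptyComplex ℕ) stepsEdge twoOptima := by
  obtain ⟨t, K, -, -, hb, hK⟩ := exists_builds_edge
  rwa [PreAbstractSimplicialComplex.ext hK] at hb

theorem builds_tetrahedron : Builds (emptyComplex ℕ) stepsTetrahedron twoOptima := by
  have h := checkTetrahedron_eq_true
  unfold checkTetrahedron at h
  split at h
  · simp at h
  · rename_i t ht
    obtain ⟨K, hK, hb⟩ := exists_builds_of_run emptyComplex_isRepresentedBy ht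
    rwa [PreAbstractSimplicialComplex.ext (faces_eq_of_isFaceSet hK h)] at hb

theorem deconstructs_edge : twoOptima.Deconstructs ![1, 1, 1, 0] := by
  have h := builds_edge.deconstructs (d := 3) (.empty _ rfl) (by decide +kernel)
  have hv : 0 + (stepsEdge.map (morseVector 3)).sum = ![1, 1, 1, 0] := by decide +kernel
  rwa [hv] at h

theorem deconstructs_tetrahedron : twoOptima.Deconstructs ![1, 0, 1, 1] := by
  have h := builds_tetrahedron.deconstructs (d := 3) (.empty _ rfl) (by decide +kernel)
  have hv : 0 + (stepsTetrahedron.map (morseVector 3)).sum = ![1, 0, 1, 1] := by decide +kernel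
  rwa [hv] at h

theorem finite_faces : twoOptima.faces.Finite :=
  builds_edge.finite Set.finite_empty

theorem fVector_eq : twoOptima.fVector 3 = ![106, 596, 1064, 573] := by
  rw [builds_edge.fVector (d := 3) Set.finite_empty (by decide +kernel)]
  have h : (emptyComplex ℕ).fVector 3 = 0 := by
    ext i
    simp [fVector, emptyComplex]
  rw [h]
  decide +kernel

/-- The complex with the cone over `B` attached collapses both to the complex itself and to the
vertex `1`, and elementary collapses preserve contractibility in both directions. -/
theorem contractibleSpace_realization : ContractibleSpace twoOptima.realization := by
  obtain ⟨t, K, ht, hK, -, hface⟩ := exists_builds_edge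
  obtain rfl := PreAbstractSimplicialComplex.ext hface
  have h := checkCone_eq_true
  unfold checkCone at h
  rw [ht] at h
  simp only at h
  split at h
  · simp at h
  rename_i u hu
  split at h
  · simp at h
  rename_i u' hu'
  rw [Bool.and_eq_true] at h
  obtain ⟨L, hL, hKL⟩ := exists_builds_of_run hK hu
  obtain ⟨L', hL', hvL⟩ := exists_builds_of_run (vertexComplex_isRepresentedBy 1) hu'
  obtain rfl : L = L' := PreAbstractSimplicialComplex.ext
    ((hL.faces_subset hL' h.1).antisymm (hL'.faces_subset hL h.2))
  rw [← contractibleSpace_iff_of_reflTransGen (hKL.reflTransGen fun x hx => ?_),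
    contractibleSpace_iff_of_reflTransGen (hvL.reflTransGen fun x hx => ?_)]
  · exact contractibleSpace_realization_of_faces_eq rfl
  · obtain ⟨l, -, rfl⟩ := List.mem_map.1 hx
    exact ⟨l, rfl⟩
  · rcases List.mem_cons.1 hx with rfl | hx
    · exact ⟨_, rfl⟩
    · obtain ⟨l, -, rfl⟩ := List.mem_map.1 hx
      cases l <;> exact ⟨_, rfl⟩

theorem card_le_of_mem_faces {σ : Finset ℕ} (hσ : σ ∈ twoOptima.faces) : σ.card ≤ 4 := by
  obtain ⟨-, f, hf, hsub⟩ := hσ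
  have h : ∀ f ∈ facets, f.card ≤ 4 := by decide +kernel
  exact (Finset.card_le_card hsub).trans (h f hf)

theorem hasDim : twoOptima.HasDim 3 := by
  refine ⟨fun σ => card_le_of_mem_faces, {1, 2, 3, 21}, ⟨by simp, _, ?_, subset_rfl⟩, by decide⟩
  decide +kernel

/-! ### The block family of `two_optima` -/

/-- The free triangles of the nine copies of `Σ₃`, followed by the triangles of `Σ₂`. -/
def baseTriangle (i : Fin 21) : Finset ℕ :=
  ([{1, 2, 5}, {1, 2, 6}, {1, 2, 4}, {1, 3, 5}, {1, 4, 6}, {2, 3, 4}, {2, 5, 6}, {3, 4, 6},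
    {3, 5, 6}] ++ sigma2).getD i ∅

def block (i : Fin 21) : List (Finset ℕ) :=
  -- The default `[]` gives the twelve triangles of `Σ₂` empty blocks.
  [sigma3Copy 1 2 5 26, sigma3Copy 1 2 6 35, sigma3Copy 1 2 4 44, sigma3Copy 1 3 5 53,
    sigma3Copy 1 4 6 62, sigma3Copy 2 3 4 71, sigma3Copy 2 5 6 80, sigma3Copy 3 4 6 89,
    sigma3Copy 3 5 6 98].getD i []

theorem mem_facets_of_mem_block {i : Fin 21} {ρ : Finset ℕ} (h : ρ ∈ block i) : ρ ∈ facets := by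
  simp only [facets, List.mem_append]
  fin_cases i <;> simp only [block] at h <;> first | exact absurd h (List.not_mem_nil) | tauto

theorem le_or_mem_block {f : Finset ℕ} (hf : f ∈ facets) :
    (∀ v ∈ f, v ≤ 25) ∨ ∃ i, f ∈ block i := by
  have hbase : ∀ f ∈ sigma2 ++ sigma3Modified, ∀ v ∈ f, v ≤ 25 := by decide +kernel
  simp only [facets, List.mem_append] at hf
  rcases hf with (((((((((hf | hf) | hf) | hf) | hf) | hf) | hf) | hf) | hf) | hf) | hf
  · exact Or.inl (hbase f (List.mem_append_left _ hf))
  · exact Or.inl (hbase f (List.mem_append_right _ hf))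
  · exact Or.inr ⟨0, hf⟩
  · exact Or.inr ⟨1, hf⟩
  · exact Or.inr ⟨2, hf⟩
  · exact Or.inr ⟨3, hf⟩
  · exact Or.inr ⟨4, hf⟩
  · exact Or.inr ⟨5, hf⟩
  · exact Or.inr ⟨6, hf⟩
  · exact Or.inr ⟨7, hf⟩
  · exact Or.inr ⟨8, hf⟩

theorem card_of_mem_block : ∀ i, ∀ ρ ∈ block i, ρ.card = 4 := by decide +kernel

/-- Block `i` owns the nine vertices from `26 + 9 * i` on. Any block triangle other than the base
contains one of them, and this identifies the block. -/
theorem mem_range_or_mem_baseTriangle : ∀ i, ∀ ρ ∈ block i, ∀ v ∈ ρ,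
    (26 + 9 * (i : ℕ) ≤ v ∧ v < 35 + 9 * (i : ℕ)) ∨ v ∈ baseTriangle i := by decide +kernel

theorem card_baseTriangle : ∀ i, (baseTriangle i).card = 3 := by decide +kernel

theorem le_of_mem_baseTriangle : ∀ i, ∀ v ∈ baseTriangle i, v ≤ 25 := by decide +kernel

theorem baseTriangle_injective : ∀ i j, baseTriangle i = baseTriangle j → i = j := by
  decide +kernel

theorem exists_ne_baseTriangle : ∀ i, ∀ e ∈ (baseTriangle i).powersetCard 2,
    ∃ j, j ≠ i ∧ e ⊆ baseTriangle j := by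
  decide +kernel

theorem exists_mem_block_or_card_eq : ∀ i, (∃ ρ ∈ block i, baseTriangle i ⊆ ρ) ∨
    ∀ f ∈ facets, baseTriangle i ⊆ f → f.card = 3 := by
  decide +kernel

theorem exists_mem_facets : ∀ i, ∃ f ∈ facets, baseTriangle i ⊆ f := by
  decide +kernel

/-- Bitwise form of the absence of further free triangles: the face opposite `v` is the base or lies
in a block tetrahedron avoiding `v`, which is therefore a different one. -/
theorem mask_triangle_check : ∀ i, (block i).all (fun ρ => decide (∀ v ∈ ρ,
    ((mask ρ - 2 ^ v).beq (mask (baseTriangle i)) ||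
      (block i).any fun ρ' => !((mask ρ').testBit v) &&
        ((mask ρ - 2 ^ v) &&& mask ρ').beq (mask ρ - 2 ^ v)) = true)) = true := by
  decide +kernel

theorem exists_mem_block_of_erase {i : Fin 21} {ρ : Finset ℕ} (hρ : ρ ∈ block i) {v : ℕ}
    (hv : v ∈ ρ) (hne : ρ.erase v ≠ baseTriangle i) :
    ∃ ρ' ∈ block i, v ∉ ρ' ∧ ρ.erase v ⊆ ρ' := by
  have h := of_decide_eq_true (List.all_eq_true.1 (mask_triangle_check i) ρ hρ) v hv
  rw [← mask_erase hv] at h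
  simp only [Bool.or_eq_true, Nat.beq_eq, mask_injective.eq_iff, List.any_eq_true,
    Bool.and_eq_true, Bool.not_eq_true'] at h
  obtain ⟨ρ', hρ', hvρ', hand⟩ := h.resolve_left hne
  refine ⟨ρ', hρ', fun hmem => ?_, fun w hw => ?_⟩
  · rw [← testBit_mask, hvρ'] at hmem
    simp at hmem
  · rw [← testBit_mask, ← hand, Nat.testBit_and, Bool.and_eq_true] at hw
    exact testBit_mask.1 hw.2

theorem exists_mem_range_of_isBlockTriangle {i : Fin 21} {τ : Finset ℕ}
    (h : IsBlockTriangle (baseTriangle i) {ρ | ρ ∈ block i} τ) (hne : τ ≠ baseTriangle i) :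
    ∃ v ∈ τ, 26 + 9 * (i : ℕ) ≤ v ∧ v < 35 + 9 * (i : ℕ) := by
  obtain ⟨hcard, hτ⟩ := h
  obtain ⟨ρ, hρ, hsub⟩ := hτ.resolve_left hne
  by_contra! hlt
  refine hne (Finset.eq_of_subset_of_card_le (fun v hv => ?_) ?_)
  · refine (mem_range_or_mem_baseTriangle i ρ hρ v (hsub hv)).resolve_left fun hr => ?_
    exact absurd hr.2 (not_lt.2 (hlt v hv hr.1))
  · rw [hcard, card_baseTriangle]

theorem isBlockTriangle_le_or_mem_range {i : Fin 21} {τ : Finset ℕ}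
    (h : IsBlockTriangle (baseTriangle i) {ρ | ρ ∈ block i} τ) {v : ℕ} (hv : v ∈ τ) :
    v ≤ 25 ∨ (26 + 9 * (i : ℕ) ≤ v ∧ v < 35 + 9 * (i : ℕ)) := by
  rcases h.2 with rfl | ⟨ρ, hρ, hsub⟩
  · exact Or.inl (le_of_mem_baseTriangle i v hv)
  · exact (mem_range_or_mem_baseTriangle i ρ hρ v (hsub hv)).symm.imp_left
      (le_of_mem_baseTriangle i v)

theorem eq_of_isBlockTriangle {i j : Fin 21} {τ : Finset ℕ}
    (hi : IsBlockTriangle (baseTriangle i) {ρ | ρ ∈ block i} τ)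
    (hj : IsBlockTriangle (baseTriangle j) {ρ | ρ ∈ block j} τ) (hne : τ ≠ baseTriangle i) :
    i = j := by
  obtain ⟨v, hv, h1, h2⟩ := exists_mem_range_of_isBlockTriangle hi hne
  rcases isBlockTriangle_le_or_mem_range hj hv with h | h
  · omega
  · exact Fin.ext (by omega)

theorem mem_facets_of_card_eq {ρ : Finset ℕ} (hρ : ρ ∈ twoOptima.faces) (h : ρ.card = 4) :
    ρ ∈ facets := by
  obtain ⟨hne, f, hf, hsub⟩ := hρ
  have hfK : f ∈ twoOptima.faces := ⟨hne.mono hsub, f, hf, subset_rfl⟩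
  rw [Finset.eq_of_subset_of_card_le hsub (by rw [h]; exact card_le_of_mem_faces hfK)]
  exact hf

theorem mem_block_of_mem {i : Fin 21} {f : Finset ℕ} (hf : f ∈ facets) {v : ℕ} (hv : v ∈ f)
    (h1 : 26 + 9 * (i : ℕ) ≤ v) (h2 : v < 35 + 9 * (i : ℕ)) : f ∈ block i := by
  rcases le_or_mem_block hf with h | ⟨j, hj⟩
  · have := h v hv
    omega
  · rcases mem_range_or_mem_baseTriangle j f hj v hv with h | h
    · obtain rfl : i = j := Fin.ext (by omega)
      exact hj
    · have := le_of_mem_baseTriangle j v h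
      omega

theorem isBlockFamily :
    IsBlockFamily twoOptima baseTriangle fun i => {ρ | ρ ∈ block i} where
  base_mem i := by
    obtain ⟨f, hf, hsub⟩ := exists_mem_facets i
    exact ⟨Finset.card_pos.1 (by rw [card_baseTriangle]; omega), f, hf, hsub⟩
  base_card := card_baseTriangle
  mem i ρ hρ := ⟨Finset.card_pos.1 (by rw [card_of_mem_block i ρ hρ]; omega), ρ,
    mem_facets_of_mem_block hρ, subset_rfl⟩
  card := card_of_mem_block
  exists_edge i e he hcard := exists_ne_baseTriangle i e (Finset.mem_powersetCard.2 ⟨he, hcard⟩)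
  disjoint i j τ hi hj := by
    by_cases h1 : τ = baseTriangle i
    · by_cases h2 : τ = baseTriangle j
      · exact baseTriangle_injective i j (h1.symm.trans h2)
      · exact (eq_of_isBlockTriangle hj hi h2).symm
    · exact eq_of_isBlockTriangle hi hj h1
  mem_of_subset i τ ρ hτ hne hρ hcard hsub := by
    obtain ⟨v, hv, h1, h2⟩ := exists_mem_range_of_isBlockTriangle hτ hne
    exact mem_block_of_mem (mem_facets_of_card_eq hρ hcard) (hsub hv) h1 h2
  exists_ne i ρ hρ τ hsub hcard hne := by
    have hρ4 := card_of_mem_block i ρ hρ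
    obtain ⟨v, hv⟩ := Finset.card_eq_one.1
      (show (ρ \ τ).card = 1 by rw [Finset.card_sdiff_of_subset hsub]; omega)
    have hvm : v ∈ ρ \ τ := by rw [hv]; simp
    have hτ : ρ.erase v = τ := by
      rw [← Finset.sdiff_singleton_eq_erase, ← hv, Finset.sdiff_sdiff_eq_self hsub]
    rw [Finset.mem_sdiff] at hvm
    obtain ⟨ρ', hρ', hvρ', hsub'⟩ := exists_mem_block_of_erase hρ hvm.1 (hτ ▸ hne)
    refine ⟨ρ', hρ', ?_, hτ ▸ hsub'⟩
    rintro rfl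
    exact hvρ' hvm.1
  exists_base i ρ hρ hcard hsub := by
    refine (exists_mem_block_or_card_eq i).resolve_right fun h => ?_
    have := h ρ (mem_facets_of_card_eq hρ hcard) hsub
    omega

/-! ### Lower bounds and optimality -/

theorem one_le_two {c : Fin 4 → ℕ} (h : twoOptima.Deconstructs c) : 1 ≤ c 2 :=
  isBlockFamily.one_le_two (fun _ => card_le_of_mem_faces) deconstructs_edge rfl h

theorem one_le_zero {c : Fin 4 → ℕ} (h : twoOptima.Deconstructs c) : 1 ≤ c 0 :=
  h.one_le_zero ⟨_, isBlockFamily.base_mem 0⟩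

theorem euler {c : Fin 4 → ℕ} (h : twoOptima.Deconstructs c) :
    (c 0 : ℤ) - c 1 + c 2 - c 3 = 1 := by
  have := h.euler finite_faces fun _ => card_le_of_mem_faces
  rw [fVector_eq] at this
  simp [Fin.sum_univ_four] at this
  linarith

theorem not_collapsible : ¬ twoOptima.Collapsible := by
  rintro ⟨L, v, hL, hv⟩
  -- A collapse to a vertex would give the Morse vector `(1, 0, 0, 0)`.
  have := one_le_two (.of_reflTransGen hL (deconstructs_of_faces_eq_singleton hv))
  simp at this

theorem setOf_isOptimalDiscreteMorseVector :
    {c : Fin 4 → ℕ | twoOptima.IsOptimalDiscreteMorseVector c} =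
      {![1, 1, 1, 0], ![1, 0, 1, 1]} := by
  have hle : ∀ c : Fin 4 → ℕ, twoOptima.IsDiscreteMorseVector c → 3 ≤ ∑ i, c i := by
    rintro c ⟨-, hc⟩
    have h0 := one_le_zero hc
    have h2 := one_le_two hc
    have he := euler hc
    rw [Fin.sum_univ_four]
    omega
  ext c
  constructor
  · rintro ⟨⟨-, hc⟩, hmin⟩
    have h0 := one_le_zero hc
    have h2 := one_le_two hc
    have he := euler hc
    have hsum := hmin _ ⟨hasDim, deconstructs_edge⟩
    simp [Fin.sum_univ_four] at hsum
    have hc0 : c 0 = 1 := by omega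
    have hc2 : c 2 = 1 := by omega
    -- The Euler relation leaves `c 1 + c 3 = 1`.
    have hc13 : (c 1 = 1 ∧ c 3 = 0) ∨ (c 1 = 0 ∧ c 3 = 1) := by omega
    rcases hc13 with ⟨hc1, hc3⟩ | ⟨hc1, hc3⟩
    · left
      ext i
      fin_cases i <;> assumption
    · right
      ext i
      fin_cases i <;> assumption
  · rintro (rfl | rfl)
    · exact ⟨⟨hasDim, deconstructs_edge⟩, fun c' hc' => by
        simpa [Fin.sum_univ_four] using hle c' hc'⟩
    · exact ⟨⟨hasDim, deconstructs_tetrahedron⟩, fun c' hc' => by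
        simpa [Fin.sum_univ_four] using hle c' hc'⟩

end TwoOptima

theorem theorem3p1 :
    twoOptima.HasDim 3 ∧
    twoOptima.fVector 3 = ![106, 596, 1064, 573] ∧
    ContractibleSpace twoOptima.realization ∧
    ¬ twoOptima.Collapsible ∧
    {c : Fin 4 → ℕ | twoOptima.IsOptimalDiscreteMorseVector c} =
      {![1, 1, 1, 0], ![1, 0, 1, 1]} :=
  ⟨TwoOptima.hasDim, TwoOptima.fVector_eq, TwoOptima.contractibleSpace_realization,
    TwoOptima.not_collapsible, TwoOptima.setOf_isOptimalDiscreteMorseVector⟩
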